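/- Let $n\ge 1$ and let $M$ be a closed (compact, without boundary) smooth manifold of dimension $2n+1$. Let $\alpha_0$ be a smooth closed nonsingular (nowhere vanishing) $1$-form on $M$ and let $\alpha$ be a smooth $1$-form on $M$ such that $\alpha_t=\alpha_0+t\alpha$ is a contact form for every $t>0$, i.e. $\alpha_t\wedge(d\alpha_t)^n$ vanishes nowhere. Then $\alpha$ is itself a contact form; let $Z$ be its Reeb vector field, i.e. the unique smooth vector field with $\alpha(Z)=1$ and $d\alpha(Z,\cdot)=0$. For each $t>0$ the forms $t\alpha$ and $\alpha_t$ are isotopic through diffeomorphisms preserving the Reeb foliation of $\alpha$: there is a smooth isotopy $(\Theta_s)_{s\in[0,1]}$ of diffeomorphisms of $M$ with $\Theta_0=\mathrm{id}_M$ and $\Theta_1^*(t\alpha)=\alpha_t$, such that every $\Theta_s$ maps each orbit of $Z$ onto an orbit of $Z$. -/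

import Mathlib

open scoped Manifold ContDiff Bundle

noncomputable section

namespace ContactIsotopy

/-! ### Exterior products of alternating forms on a real vector space -/

section Linear

variable {V : Type*} [AddCommGroup V] [Module ℝ V]

/-- The exterior product `a ∧ b` of a `k`-form and an `l`-form, given by the signed sum
over `(k, l)`-shuffles. -/
def wedge {k l : ℕ} (a : V [⋀^Fin k]→ₗ[ℝ] ℝ) (b : V [⋀^Fin l]→ₗ[ℝ] ℝ) :
    V [⋀^Fin (k + l)]→ₗ[ℝ] ℝ :=
  ((LinearMap.mul' ℝ ℝ).compAlternatingMap (a.domCoprod b)).domDomCongr finSumFinEquiv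

/-- The exterior power `η ∧ ⋯ ∧ η` (`m` factors) of a 2-form `η`. -/
def wedgePow (η : V [⋀^Fin 2]→ₗ[ℝ] ℝ) : (m : ℕ) → V [⋀^Fin (2 * m)]→ₗ[ℝ] ℝ
  | 0 => AlternatingMap.constOfIsEmpty ℝ V (Fin 0) 1
  | m + 1 => wedge (wedgePow η m) η

/-- A linear functional, regarded as an alternating form of degree 1. -/
def toForm (a : V →ₗ[ℝ] ℝ) : V [⋀^Fin 1]→ₗ[ℝ] ℝ :=
  AlternatingMap.ofSubsingleton ℝ V ℝ (0 : Fin 1) a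

end Linear

/-! ### Smooth 1-forms and vector fields on a manifold without boundary -/

section Manifold

variable {d : ℕ} {M : Type*} [TopologicalSpace M] [ChartedSpace (EuclideanSpace ℝ (Fin d)) M]

/-- Smooth 1-forms on the `d`-dimensional manifold `M`: smooth sections of the cotangent
bundle. -/
abbrev OneForm (d : ℕ) (M : Type*) [TopologicalSpace M]
    [ChartedSpace (EuclideanSpace ℝ (Fin d)) M] [IsManifold (𝓡 d) ∞ M] :=
  ContMDiffSection (𝓡 d) (EuclideanSpace ℝ (Fin d) →L[ℝ] ℝ) ∞
    (fun x : M ↦ TangentSpace (𝓡 d) x →L[ℝ] ℝ)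

/-- The expression of the 1-form `α` in the chart at `x`, i.e. the pullback of `α` to a
subset of `ℝᵈ` under the inverse of this chart. -/
def chartForm (α : (x : M) → TangentSpace (𝓡 d) x →L[ℝ] ℝ) (x : M)
    (y : EuclideanSpace ℝ (Fin d)) : EuclideanSpace ℝ (Fin d) →L[ℝ] ℝ :=
  (α ((extChartAt (𝓡 d) x).symm y)).comp
    (mfderiv 𝓘(ℝ, EuclideanSpace ℝ (Fin d)) (𝓡 d) (extChartAt (𝓡 d) x).symm y)

/-- The exterior derivative `dα` of a 1-form `α`, at the point `x`: the exterior derivative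
of the expression of `α` in the chart at `x`, pulled back to `M` by this chart. -/
def extD (α : (x : M) → TangentSpace (𝓡 d) x →L[ℝ] ℝ) (x : M) :
    TangentSpace (𝓡 d) x [⋀^Fin 2]→L[ℝ] ℝ :=
  (extDeriv
      (fun y ↦ ContinuousAlternatingMap.ofSubsingleton ℝ (EuclideanSpace ℝ (Fin d)) ℝ
        (0 : Fin 1) (chartForm α x y))
      (extChartAt (𝓡 d) x x)).compContinuousLinearMap
    (mfderiv (𝓡 d) 𝓘(ℝ, EuclideanSpace ℝ (Fin d)) (extChartAt (𝓡 d) x) x)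

/-- The 1-form `α` is closed: `dα = 0`. -/
def IsClosedForm (α : (x : M) → TangentSpace (𝓡 d) x →L[ℝ] ℝ) : Prop :=
  ∀ x, extD α x = 0

/-- The 1-form `α` is nonsingular: it vanishes at no point. -/
def IsNonsingular (α : (x : M) → TangentSpace (𝓡 d) x →L[ℝ] ℝ) : Prop :=
  ∀ x, α x ≠ 0

/-- `Z` is the Reeb vector field of `α`: a smooth vector field with `α(Z) = 1` and
`dα(Z, X) = 0` for all `X`. -/
structure IsReebField [IsManifold (𝓡 d) ∞ M] (α : (x : M) → TangentSpace (𝓡 d) x →L[ℝ] ℝ)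
    (Z : (x : M) → TangentSpace (𝓡 d) x) : Prop where
  smooth : ContMDiff (𝓡 d) (𝓡 d).tangent ∞ (fun x ↦ (⟨x, Z x⟩ : TangentBundle (𝓡 d) M))
  apply_eq_one : ∀ x, α x (Z x) = 1
  extD_eq_zero : ∀ x (v : TangentSpace (𝓡 d) x), extD α x ![Z x, v] = 0

/-- The leaf through `x` of the foliation by the orbits of the vector field `Z`
(for a complete `Z`): all the points on the integral curve of `Z` that starts at `x`. -/
def orbit (Z : (x : M) → TangentSpace (𝓡 d) x) (x : M) : Set M :=
  {y | ∃ γ : ℝ → M, IsMIntegralCurve γ Z ∧ γ 0 = x ∧ ∃ s, γ s = y}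

/-- The map `φ` preserves the foliation by the orbits of `Z`: it maps each leaf onto a leaf. -/
def PreservesOrbits (Z : (x : M) → TangentSpace (𝓡 d) x) (φ : M → M) : Prop :=
  ∀ x, φ '' orbit Z x = orbit Z (φ x)

/-- `η' = φ^* η` for 1-forms `η`, `η'`. -/
def IsPullback (φ : M → M) (η η' : (x : M) → TangentSpace (𝓡 d) x →L[ℝ] ℝ) : Prop :=
  ∀ x, η' x = (η (φ x)).comp (mfderiv (𝓡 d) (𝓡 d) φ x)

/-- `Θ` is, for parameters in `[0, 1]`, a smooth isotopy (of diffeomorphisms of `M`) that starts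
at the identity. -/
structure IsIsotopy (Θ : ℝ → M ≃ₘ⟮𝓡 d, 𝓡 d⟯ M) : Prop where
  smooth : ContMDiffOn (𝓘(ℝ, ℝ).prod (𝓡 d)) (𝓡 d) ∞ (fun p : ℝ × M ↦ Θ p.1 p.2)
    (Set.Icc (0 : ℝ) 1 ×ˢ Set.univ)
  zero : ∀ x, Θ 0 x = x

/-- Two 1-forms `η` and `η'` are isotopic through diffeomorphisms with the property `P`: there
is an isotopy `Θ` from the identity with `η' = Θ₁^* η`, all of whose stages have the
property `P`. -/
def IsotopicThrough (P : (M → M) → Prop) (η η' : (x : M) → TangentSpace (𝓡 d) x →L[ℝ] ℝ) :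
    Prop :=
  ∃ Θ : ℝ → M ≃ₘ⟮𝓡 d, 𝓡 d⟯ M, IsIsotopy Θ ∧ IsPullback (Θ 1) η η' ∧
    ∀ s ∈ Set.Icc (0 : ℝ) 1, P (Θ s)

end Manifold

/-- The 1-form `α` on a `(2n+1)`-dimensional manifold is a contact form: the form
`α ∧ (dα)ⁿ` of top degree vanishes at no point. -/
def IsContactForm {n : ℕ} {M : Type*} [TopologicalSpace M]
    [ChartedSpace (EuclideanSpace ℝ (Fin (2 * n + 1))) M]
    (α : (x : M) → TangentSpace (𝓡 (2 * n + 1)) x →L[ℝ] ℝ) : Prop :=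
  ∀ x, wedge (toForm (α x).toLinearMap) (wedgePow (extD α x).toAlternatingMap n) ≠ 0

end ContactIsotopy

end

/-!
Write `η = dα`. Since `α₀` is closed, `dα_t = t η`. A contact form `a` in dimension `2n + 1` has
trivial kernel: `a` and `da` have no common kernel vector (`eq_zero_of_wedge_ne_zero`), and then
`da + a ⊗ a` is a nondegenerate bilinear form, through which 1-forms are represented by smooth
vector fields (`exists_dual_vectorField`).

*The form `α₀` vanishes on the Reeb field `R` of `a = α₀ + α`.* Put `f = α₀(R)`, so that
`α(R) = 1 - f`. The vector `R` is in the kernel of `η`, hence `α_t(R) = f + t (1 - f)` has no zero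
`t > 0`, and this forces `f ≥ 0` (`apply_reeb_nonneg`). On the other hand `α₀ ∧ ηⁿ` is exact, and
it is `f` times the volume form `a ∧ ηⁿ`, so `f` should vanish by Stokes' theorem. As Mathlib has no
integration of differential forms on manifolds, the argument is carried out with densities: let `Y`
be the vector field with `a(Y) = 0` and `η(Y, ·) = f a - α₀`; its divergence with respect to the
density `√|det (da + a ⊗ a)|` is `n f` (`divergence_density`). The density obeys the change of
variables formula between charts (`chartIntegral_eq_of_support`), the divergence theorem holds in
each chart (`chartIntegral_divergence`), and a partition of unity gives `∫ n f = 0`, whence `f = 0`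
because `n ≥ 1` (`apply_reeb_eq_zero_of_nonneg`).

*Conclusion.* The field `R` lies in the kernels of `α₀` and `η`, so `α₀ ∧ ηⁿ = 0` and
`α ∧ ηⁿ = a ∧ ηⁿ` vanishes nowhere: `α` is a contact form (`isContactForm_of_add`), and `R` is
its Reeb field. Let `X` be the vector field with `α(X) = 0` and `η(X, ·) = α₀`. Then
`α₀(X) = η(X, X) = 0`, so by Cartan's formula (`IsFlow.hasDerivAt_pullback`) the flow `Φ` of `X`
satisfies `Φ_s^* α₀ = α₀` and `Φ_s^* α = α + s α₀`. Hence `Θ_s = Φ_{s/t}` is the isotopy sought.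
As `R` is also the Reeb field of each `α + s α₀`, it is invariant under `Φ_s`
(`IsFlow.mfderiv_reeb`), so its orbits are permuted.

The existence and smoothness of the global flow of a vector field on a closed manifold is not in
Mathlib; it is obtained in `exists_isFlow`, from the implicit function theorem in the Banach space
of paths (`contDiffAt_localFlow`).
-/

noncomputable section

namespace ContactIsotopy

/-! ### Smooth dependence of local flows on the initial point -/

section LocalFlow

open Set Filter Topology MeasureTheory

variable {E F : Type} [NormedAddCommGroup E] [NormedSpace ℝ E]
  [NormedAddCommGroup F] [NormedSpace ℝ F]

/-- The superposition operator `γ ↦ f ∘ γ` on continuous maps. -/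
def superposition (K : Type) [TopologicalSpace K] (f : E → F) (hf : Continuous f) (γ : C(K, E)) :
    C(K, F) :=
  (⟨f, hf⟩ : C(E, F)).comp γ

/-- Shortcut: the generic search for this instance is too slow. -/
instance instNormedAddCommGroupContinuousMapCLM (K : Type) [TopologicalSpace K] [CompactSpace K] :
    NormedAddCommGroup C(K, E →L[ℝ] F) :=
  ContinuousMap.instNormedAddCommGroup

/-- Pointwise application of a continuous family of linear maps, as a continuous linear map into
the operators between spaces of continuous maps. -/
def pointwiseApply (K : Type) [TopologicalSpace K] [CompactSpace K] :
    C(K, E →L[ℝ] F) →L[ℝ] C(K, E) →L[ℝ] C(K, F) :=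
  LinearMap.mkContinuous₂
    (LinearMap.mk₂ ℝ (fun (A : C(K, E →L[ℝ] F)) (γ : C(K, E)) ↦
        (⟨fun s ↦ A s (γ s), by fun_prop⟩ : C(K, F)))
      (fun _ _ _ ↦ by ext; simp) (fun _ _ _ ↦ by ext; simp)
      (fun _ _ _ ↦ by ext; simp) (fun _ _ _ ↦ by ext; simp)) 1 (fun A γ ↦ by
        rw [one_mul, ContinuousMap.norm_le _ (by positivity)]
        intro s
        exact (A s).le_of_opNorm_le_of_le (A.norm_coe_le_norm s) (γ.norm_coe_le_norm s))

lemma hasFDerivAt_superposition {K : Type} [TopologicalSpace K] [CompactSpace K] {f : E → F}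
    (hf : ContDiff ℝ 1 f) (γ : C(K, E)) :
    HasFDerivAt (superposition K f hf.continuous)
      (pointwiseApply K (superposition K (fderiv ℝ f) (hf.continuous_fderiv (by simp)) γ)) γ := by
  rw [hasFDerivAt_iff_isLittleO_nhds_zero, Asymptotics.isLittleO_iff]
  intro c hc
  -- uniform continuity of the derivative along the compact image of `γ`
  have hcont := hf.continuous_fderiv (by simp)
  have key : ∀ᶠ δ in 𝓝 (0 : E), ∀ s : K, ‖fderiv ℝ f (γ s + δ) - fderiv ℝ f (γ s)‖ < c := by
    have h := (isCompact_univ (X := K)).eventually_forall_of_forall_eventually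
      (x₀ := (0 : E)) (P := fun δ s ↦ ‖fderiv ℝ f (γ s + δ) - fderiv ℝ f (γ s)‖ < c) ?_
    · simpa using h
    · intro s _
      have : ContinuousAt (fun z : E × K ↦
          ‖fderiv ℝ f (γ z.2 + z.1) - fderiv ℝ f (γ z.2)‖) (0, s) := by
        refine ContinuousAt.norm (ContinuousAt.sub ?_ ?_) <;>
        exact (hcont.comp (by fun_prop)).continuousAt
      exact this.eventually_lt_const (by simpa using hc)
  obtain ⟨r, hr, hr'⟩ := Metric.eventually_nhds_iff_ball.1 key
  filter_upwards [Metric.ball_mem_nhds (0 : C(K, E)) hr] with h hh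
  rw [ContinuousMap.norm_le _ (by positivity)]
  intro s
  have hhs : ‖h s‖ < r := (h.norm_coe_le_norm s).trans_lt (by simpa using hh)
  have hmv := (convex_ball (γ s) r).norm_image_sub_le_of_norm_hasFDerivWithin_le'
    (f := f) (f' := fun y ↦ fderiv ℝ f y) (φ := fderiv ℝ f (γ s)) (C := c)
    (x := γ s) (y := γ s + h s)
    (fun y _ ↦ (hf.differentiable (by simp) y).hasFDerivAt.hasFDerivWithinAt)
    (fun y hy ↦ by
      have := hr' (y - γ s) (by simpa [dist_eq_norm] using hy) s
      rw [add_sub_cancel] at this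
      exact this.le)
    (Metric.mem_ball_self hr) (by simpa using hhs)
  simp only [add_sub_cancel_left] at hmv
  refine hmv.trans (mul_le_mul_of_nonneg_left (h.norm_coe_le_norm s) hc.le)

/-- The derivative of a superposition operator is again built from one, with another target space;
hence the target is generalized in the induction. -/
lemma contDiff_superposition_nat {K : Type} [TopologicalSpace K] [CompactSpace K] (n : ℕ) :
    ∀ {F : Type} [NormedAddCommGroup F] [NormedSpace ℝ F] {f : E → F} (hf : ContDiff ℝ ∞ f),
      ContDiff ℝ n (superposition K f hf.continuous) := by
  induction n with
  | zero =>
    intro F _ _ f hf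
    exact contDiff_zero.2 (ContinuousMap.continuous_postcomp _)
  | succ n ih =>
    intro F _ _ f hf
    have h1 : ContDiff ℝ 1 f := hf.of_le (by exact_mod_cast le_top)
    have h2 : ContDiff ℝ ∞ (fderiv ℝ f) := hf.fderiv_right (by simp)
    push_cast
    rw [contDiff_succ_iff_hasFDerivAt]
    have h3 : ContDiff ℝ n (fun A ↦ pointwiseApply (E := E) (F := F) K A) :=
      ContinuousLinearMap.contDiff _
    refine ⟨fun γ ↦ pointwiseApply K (superposition K (fderiv ℝ f) h2.continuous γ),
      h3.comp (ih h2), fun γ ↦ hasFDerivAt_superposition h1 γ⟩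

lemma contDiff_superposition {K : Type} [TopologicalSpace K] [CompactSpace K] {f : E → F}
    (hf : ContDiff ℝ ∞ f) : ContDiff ℝ ∞ (superposition K f hf.continuous) :=
  contDiff_infty.2 fun n ↦ contDiff_superposition_nat n hf

/-- The Volterra operator `γ ↦ (s ↦ ∫₀ˢ γ)` on continuous maps of the unit interval. -/
def volterra (E : Type) [NormedAddCommGroup E] [NormedSpace ℝ E] :
    C(unitInterval, E) →L[ℝ] C(unitInterval, E) :=
  have hi (γ : C(unitInterval, E)) (a b : ℝ) :
      IntervalIntegrable (fun r ↦ γ (projIcc 0 1 zero_le_one r)) volume a b :=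
    (γ.continuous.comp continuous_projIcc).intervalIntegrable _ _
  LinearMap.mkContinuous
    { toFun := fun γ ↦ ⟨fun s ↦ ∫ r in (0 : ℝ)..s, γ (projIcc 0 1 zero_le_one r),
        (intervalIntegral.continuous_primitive (hi γ) 0).comp continuous_subtype_val⟩
      map_add' := fun γ δ ↦ by
        ext s
        exact intervalIntegral.integral_add (hi γ _ _) (hi δ _ _)
      map_smul' := fun c γ ↦ by
        ext s
        exact intervalIntegral.integral_smul c _ } 1 (fun γ ↦ by
      rw [one_mul, ContinuousMap.norm_le _ (by positivity)]
      intro s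
      refine (intervalIntegral.norm_integral_le_of_norm_le_const
        fun r _ ↦ γ.norm_coe_le_norm _).trans ?_
      rw [sub_zero, abs_of_nonneg s.2.1]
      exact mul_le_of_le_one_right (norm_nonneg _) s.2.2)

/-- A local flow of a smooth bounded vector field is jointly smooth at time zero. The path
`s ↦ σ (s t) x` solves the fixed point equation `γ = x + t ∫ f(γ)` in `C([0, 1], E)`, to which the
implicit function theorem applies at `t = 0`, where the derivative in `γ` is the identity. -/
theorem contDiffAt_localFlow [CompleteSpace E] {f : E → E} (hf : ContDiff ℝ ∞ f) {C : ℝ}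
    (hC : ∀ y, ‖f y‖ ≤ C)
    {σ : ℝ → E → E} {y₀ : E} {ε : ℝ} (hε : 0 < ε) (hσ : ∀ᶠ y in 𝓝 y₀, σ 0 y = y ∧
      ∀ t ∈ Ioo (-ε) ε, HasDerivAt (fun t ↦ σ t y) (f (σ t y)) t) :
    ContDiffAt ℝ ∞ (fun p : ℝ × E ↦ σ p.1 p.2) (0, y₀) := by
  let const : E →L[ℝ] C(unitInterval, E) := ContinuousLinearMap.const ℝ unitInterval
  let G : (ℝ × E) × C(unitInterval, E) → C(unitInterval, E) := fun z ↦
    z.2 - const z.1.2 - z.1.1 • volterra E (superposition unitInterval f hf.continuous z.2)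
  let u : (ℝ × E) × C(unitInterval, E) := ((0, y₀), const y₀)
  have hGs : ContDiff ℝ ∞ G := by
    refine (contDiff_snd.sub (const.contDiff.comp (contDiff_snd.comp contDiff_fst))).sub ?_
    exact (contDiff_fst.comp contDiff_fst).smul
      ((volterra E).contDiff.comp ((contDiff_superposition hf).comp contDiff_snd))
  have hGu : G u = 0 := by simp [G, u]
  have hinv : (fderiv ℝ G u ∘L .inr ℝ (ℝ × E) C(unitInterval, E)).IsInvertible := by
    have h1 : HasFDerivAt (fun γ ↦ G ((0, y₀), γ))
        (fderiv ℝ G u ∘L .inr ℝ (ℝ × E) C(unitInterval, E)) (const y₀) :=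
      HasFDerivAt.comp (g := G) (f := fun γ ↦ ((0, y₀), γ)) (const y₀)
        (hGs.differentiable (by simp) u).hasFDerivAt (hasFDerivAt_prodMk_right _ _)
    have h2 : HasFDerivAt (fun γ ↦ G ((0, y₀), γ)) (ContinuousLinearMap.id ℝ C(unitInterval, E))
        (const y₀) := by
      simpa [G] using (hasFDerivAt_id (𝕜 := ℝ) (const y₀)).sub_const (const y₀)
    rw [h1.unique h2]
    exact ⟨.refl ℝ _, rfl⟩
  have hcd : ContDiffAt ℝ ∞ G u := hGs.contDiffAt
  set ψ := hcd.implicitFunction (by simp) hinv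
  have hψ : ContDiffAt ℝ ∞ ψ (0, y₀) := hcd.contDiffAt_implicitFunction (by simp) hinv
  have hiff := hcd.eventually_apply_eq_iff_implicitFunction (by simp) hinv
  have hC0 : 0 ≤ C := (norm_nonneg _).trans (hC y₀)
  -- the rescaled trajectories solve the fixed point equation and are close to `const y₀`
  have hpath : ∀ᶠ p in 𝓝 ((0 : ℝ), y₀), ∃ γ : C(unitInterval, E),
      G (p, γ) = 0 ∧ γ 1 = σ p.1 p.2 ∧ ‖γ - const y₀‖ ≤ ‖p.2 - y₀‖ + C * |p.1| := by
    have ht : ∀ᶠ t in 𝓝 (0 : ℝ), t ∈ Ioo (-ε) ε := Ioo_mem_nhds (by linarith) hε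
    filter_upwards [ht.prod_nhds hσ] with ⟨t, y⟩ ⟨ht, hy0, hy⟩
    dsimp only at ht hy0 hy ⊢
    have hmem (s : ℝ) (hs : s ∈ Icc (0 : ℝ) 1) : s * t ∈ Ioo (-ε) ε := by
      rw [mem_Ioo, ← abs_lt, abs_mul, abs_of_nonneg hs.1]
      exact (mul_le_of_le_one_left (abs_nonneg _) hs.2).trans_lt (abs_lt.2 ht)
    have hd (s : ℝ) (hs : s ∈ Icc (0 : ℝ) 1) :
        HasDerivAt (fun s ↦ σ (s * t) y) (t • f (σ (s * t) y)) s := by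
      simpa [Function.comp_def] using (hy _ (hmem s hs)).scomp s ((hasDerivAt_id s).mul_const t)
    have hc : ContinuousOn (fun s ↦ σ (s * t) y) (Icc 0 1) := fun s hs ↦
      (hd s hs).continuousAt.continuousWithinAt
    let γ : C(unitInterval, E) := ⟨fun s ↦ σ (s * t) y, hc.domRestrict⟩
    have hint (s : unitInterval) : σ (s * t) y - y =
        t • ∫ r in (0 : ℝ)..s, f (γ (projIcc 0 1 zero_le_one r)) := by
      rw [← intervalIntegral.integral_smul]
      have h := intervalIntegral.integral_eq_sub_of_hasDerivAt (a := 0) (b := s)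
        (f := fun s ↦ σ (s * t) y) (f' := fun r ↦ t • f (σ (r * t) y)) ?_ ?_
      · simp only [zero_mul, hy0] at h
        rw [← h]
        refine intervalIntegral.integral_congr fun r hr ↦ ?_
        rw [uIcc_of_le s.2.1] at hr
        simp only [γ, projIcc_of_mem zero_le_one ⟨hr.1, hr.2.trans s.2.2⟩]
        rfl
      · intro r hr
        rw [uIcc_of_le s.2.1] at hr
        exact hd r ⟨hr.1, hr.2.trans s.2.2⟩
      · refine ContinuousOn.intervalIntegrable ?_
        rw [uIcc_of_le s.2.1]
        exact (hf.continuous.comp_continuousOn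
          (hc.mono (Icc_subset_Icc_right s.2.2))).const_smul t
    refine ⟨γ, ?_, congrArg (fun s ↦ σ s y) (one_mul t), ?_⟩
    · ext s
      have : G ((t, y), γ) s = σ (s * t) y - y -
        t • ∫ r in (0 : ℝ)..s, f (γ (projIcc 0 1 zero_le_one r)) := rfl
      rw [this, hint s, sub_self]
      rfl
    · rw [ContinuousMap.norm_le _ (by positivity)]
      intro s
      have h1 : (γ - const y₀) s = (y - y₀) +
          t • ∫ r in (0 : ℝ)..s, f (γ (projIcc 0 1 zero_le_one r)) := by
        rw [← hint s]
        change σ (s * t) y - y₀ = _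
        abel
      rw [h1]
      refine (norm_add_le _ _).trans (add_le_add le_rfl ?_)
      rw [norm_smul, mul_comm, Real.norm_eq_abs]
      gcongr
      refine (intervalIntegral.norm_integral_le_of_norm_le_const fun r _ ↦ hC _).trans ?_
      rw [sub_zero, abs_of_nonneg s.2.1]
      exact mul_le_of_le_one_right hC0 s.2.2
  have hev : ∀ᶠ p in 𝓝 ((0 : ℝ), y₀), σ p.1 p.2 = ψ p 1 := by
    obtain ⟨r, hr, hr'⟩ := Metric.eventually_nhds_iff_ball.1 hiff
    have hsmall : ∀ᶠ p in 𝓝 ((0 : ℝ), y₀), ‖p.2 - y₀‖ + C * |p.1| < r := by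
      have : ContinuousAt (fun p : ℝ × E ↦ ‖p.2 - y₀‖ + C * |p.1|) (0, y₀) := by fun_prop
      exact this.eventually_lt_const (by simpa using hr)
    filter_upwards [hpath, hsmall, Metric.ball_mem_nhds ((0 : ℝ), y₀) hr]
      with p ⟨γ, hγ, hγ1, hγn⟩ hp hpb
    have hmem : (p, γ) ∈ Metric.ball u r := by
      rw [Metric.mem_ball, Prod.dist_eq, max_lt_iff]
      exact ⟨hpb, by rw [dist_eq_norm]; exact hγn.trans_lt hp⟩
    have := (hr' _ hmem).1 (by rw [hγ, hGu])
    rw [← hγ1]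
    exact congrArg (fun δ : C(unitInterval, E) ↦ δ 1) this.symm
  have : ContDiffAt ℝ ∞ (fun p ↦ ψ p 1) (0, y₀) :=
    (ContinuousMap.evalCLM (M := E) ℝ (1 : unitInterval)).contDiff.contDiffAt.comp _ hψ
  exact this.congr_of_eventuallyEq hev

end LocalFlow

/-! ### The exterior derivative of a 1-form on a vector space -/

section ExteriorDerivative

variable {E : Type*} [NormedAddCommGroup E] [NormedSpace ℝ E]
  {F : Type*} [NormedAddCommGroup F] [NormedSpace ℝ F]

/-- The exterior derivative of a 1-form on a vector space, as a bilinear form. -/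
def dForm (a : E → E →L[ℝ] ℝ) (y : E) : E →L[ℝ] E →L[ℝ] ℝ :=
  fderiv ℝ a y - (fderiv ℝ a y).flip

lemma dForm_apply (a : E → E →L[ℝ] ℝ) (y u w : E) :
    dForm a y u w = fderiv ℝ a y u w - fderiv ℝ a y w u := rfl

lemma dForm_congr {a b : E → E →L[ℝ] ℝ} {y : E}
    (h : a =ᶠ[nhds y] b) : dForm a y = dForm b y := by
  rw [dForm, dForm, h.fderiv_eq]

/-- Naturality of the exterior derivative: the second derivatives of `g` cancel by symmetry. -/
lemma dForm_pullback {a : F → F →L[ℝ] ℝ} {g : E → F} {y : E}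
    (ha : DifferentiableAt ℝ a (g y)) (hg : ContDiffAt ℝ 2 g y) (u w : E) :
    dForm (fun z ↦ (a (g z)).comp (fderiv ℝ g z)) y u w =
      dForm a (g y) (fderiv ℝ g y u) (fderiv ℝ g y w) := by
  have hg1 : DifferentiableAt ℝ g y := hg.differentiableAt (by simp)
  have hg2 : DifferentiableAt ℝ (fderiv ℝ g) y :=
    (hg.fderiv_right (m := 1) (by norm_num)).differentiableAt (by simp)
  have hsymm : fderiv ℝ (fderiv ℝ g) y u w = fderiv ℝ (fderiv ℝ g) y w u :=
    (hg.isSymmSndFDerivAt (by simp)) u w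
  have h := (ha.hasFDerivAt.comp y hg1.hasFDerivAt).clm_comp hg2.hasFDerivAt
  have h' : fderiv ℝ (fun z ↦ (a (g z)).comp (fderiv ℝ g z)) y = _ := h.fderiv
  simp only [dForm_apply, h']
  simp [hsymm]

lemma extDeriv_ofSubsingleton {a : E → E →L[ℝ] ℝ} {y : E} (ha : DifferentiableAt ℝ a y)
    (v : Fin 2 → E) :
    extDeriv (fun z ↦ ContinuousAlternatingMap.ofSubsingleton ℝ E ℝ (0 : Fin 1) (a z)) y v =
      dForm a y (v 0) (v 1) := by
  have h : HasFDerivAt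
      (fun z ↦ ContinuousAlternatingMap.ofSubsingleton ℝ E ℝ (0 : Fin 1) (a z))
      ((ContinuousAlternatingMap.ofSubsingletonLIE (𝕜 := ℝ) (E := E) (F := ℝ) (0 : Fin 1)
        |>.toContinuousLinearEquiv.toContinuousLinearMap).comp (fderiv ℝ a y)) y :=
    (ContinuousAlternatingMap.ofSubsingletonLIE (𝕜 := ℝ) (E := E) (F := ℝ) (0 : Fin 1)
        |>.toContinuousLinearEquiv.toContinuousLinearMap).hasFDerivAt.comp y ha.hasFDerivAt
  have h' (w u : E) : fderiv ℝ (fun z ↦ a z w) y u = fderiv ℝ a y u w := by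
    rw [(ha.hasFDerivAt.clm_apply (hasFDerivAt_const w y)).fderiv]
    simp
  rw [extDeriv_apply h.differentiableAt, dForm_apply, Fin.sum_univ_two]
  simp [Fin.removeNth, Fin.tail, sub_eq_add_neg, h']

end ExteriorDerivative

/-! ### Forms and vector fields in charts -/

section Charts

open Set Filter Topology

variable {d : ℕ} {M : Type*} [TopologicalSpace M] [ChartedSpace (EuclideanSpace ℝ (Fin d)) M]

local notation "𝔼" => EuclideanSpace ℝ (Fin d)

/-- The derivative at `x` of the chart centred at `c`. -/
def dChart (c x : M) : TangentSpace (𝓡 d) x →L[ℝ] 𝔼 :=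
  mfderiv (𝓡 d) 𝓘(ℝ, 𝔼) (extChartAt (𝓡 d) c) x

/-- The derivative at `y` of the inverse of the chart centred at `c`. -/
def dChartSymm (c : M) (y : 𝔼) : 𝔼 →L[ℝ] TangentSpace (𝓡 d) ((extChartAt (𝓡 d) c).symm y) :=
  mfderiv 𝓘(ℝ, 𝔼) (𝓡 d) (extChartAt (𝓡 d) c).symm y

/-- The expression of the vector field `X` in the chart centred at `c`. -/
def chartVec (X : (x : M) → TangentSpace (𝓡 d) x) (c : M) (y : 𝔼) : 𝔼 :=
  dChart c ((extChartAt (𝓡 d) c).symm y) (X ((extChartAt (𝓡 d) c).symm y))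

lemma chartForm_apply (α : (x : M) → TangentSpace (𝓡 d) x →L[ℝ] ℝ) (c : M) (y u : 𝔼) :
    chartForm α c y u = α ((extChartAt (𝓡 d) c).symm y) (dChartSymm c y u) := rfl

lemma range_euclidean_model : range (𝓡 d) = univ :=
  ModelWithCorners.Boundaryless.range_eq_univ

variable [IsManifold (𝓡 d) ∞ M]

lemma dChart_dChartSymm {c : M} {y : 𝔼} (hy : y ∈ (extChartAt (𝓡 d) c).target) (u : 𝔼) :
    dChart c ((extChartAt (𝓡 d) c).symm y) (dChartSymm c y u) = u := by
  have h := mfderiv_extChartAt_comp_mfderivWithin_extChartAt_symm (I := 𝓡 d) hy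
  rw [range_euclidean_model, mfderivWithin_univ] at h
  exact congrArg (fun A ↦ A u) h

lemma dChartSymm_dChart {c : M} {y : 𝔼} (hy : y ∈ (extChartAt (𝓡 d) c).target)
    (v : TangentSpace (𝓡 d) ((extChartAt (𝓡 d) c).symm y)) :
    dChartSymm c y (dChart c ((extChartAt (𝓡 d) c).symm y) v) = v := by
  have h := mfderivWithin_extChartAt_symm_comp_mfderiv_extChartAt (I := 𝓡 d) hy
  rw [range_euclidean_model, mfderivWithin_univ] at h
  exact congrArg (fun A ↦ A v) h

lemma dChartSymm_chartVec (X : (x : M) → TangentSpace (𝓡 d) x) {c : M} {y : 𝔼}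
    (hy : y ∈ (extChartAt (𝓡 d) c).target) :
    dChartSymm c y (chartVec X c y) = X ((extChartAt (𝓡 d) c).symm y) :=
  dChartSymm_dChart hy _

lemma chartForm_dChart (α : (x : M) → TangentSpace (𝓡 d) x →L[ℝ] ℝ) {c x : M}
    (hx : x ∈ (extChartAt (𝓡 d) c).source) (v : TangentSpace (𝓡 d) x) :
    chartForm α c (extChartAt (𝓡 d) c x) (dChart c x v) = α x v := by
  obtain ⟨y, hy, rfl⟩ : ∃ y ∈ (extChartAt (𝓡 d) c).target, (extChartAt (𝓡 d) c).symm y = x :=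
    ⟨_, (extChartAt (𝓡 d) c).map_source hx, (extChartAt (𝓡 d) c).left_inv hx⟩
  rw [(extChartAt (𝓡 d) c).right_inv hy, chartForm_apply, dChartSymm_dChart hy]

lemma chartForm_chartVec (α : (x : M) → TangentSpace (𝓡 d) x →L[ℝ] ℝ)
    (X : (x : M) → TangentSpace (𝓡 d) x) {c : M} {y : 𝔼}
    (hy : y ∈ (extChartAt (𝓡 d) c).target) :
    chartForm α c y (chartVec X c y) =
      α ((extChartAt (𝓡 d) c).symm y) (X ((extChartAt (𝓡 d) c).symm y)) := by
  rw [chartForm_apply, dChartSymm_chartVec X hy]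

lemma dChart_bijective {c x : M} (hx : x ∈ (extChartAt (𝓡 d) c).source) :
    Function.Bijective (dChart (d := d) c x) := by
  obtain ⟨y, hy, rfl⟩ : ∃ y ∈ (extChartAt (𝓡 d) c).target, (extChartAt (𝓡 d) c).symm y = x :=
    ⟨_, (extChartAt (𝓡 d) c).map_source hx, (extChartAt (𝓡 d) c).left_inv hx⟩
  exact ⟨Function.LeftInverse.injective (g := dChartSymm c y) (dChartSymm_dChart hy),
    Function.RightInverse.surjective (g := dChartSymm c y) (dChart_dChartSymm hy)⟩

lemma trivializationAt_snd {c x : M} (hx : x ∈ (chartAt 𝔼 c).source) (v : TangentSpace (𝓡 d) x) :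
    (trivializationAt 𝔼 (TangentSpace (𝓡 d)) c ⟨x, v⟩).2 = dChart c x v := by
  have h := TangentBundle.continuousLinearMapAt_trivializationAt (I := 𝓡 d) hx
  rw [dChart, ← h, Bundle.Trivialization.continuousLinearMapAt_apply,
    Bundle.Trivialization.linearMapAt_apply]
  rw [if_pos (by simpa using hx)]

lemma contMDiffOn_vectorField_iff {X : (x : M) → TangentSpace (𝓡 d) x} (c : M) :
    ContMDiffOn (𝓡 d) (𝓡 d).tangent ∞ (fun x ↦ (⟨x, X x⟩ : TangentBundle (𝓡 d) M))
      (chartAt 𝔼 c).source ↔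
    ContMDiffOn (𝓡 d) 𝓘(ℝ, 𝔼) ∞ (fun x ↦ dChart c x (X x)) (chartAt 𝔼 c).source := by
  have h := (trivializationAt 𝔼 (TangentSpace (𝓡 d) : M → Type) c).contMDiffOn_section_baseSet_iff
    (IB := 𝓡 d) (n := ∞) (s := X)
  rw [TangentBundle.trivializationAt_baseSet] at h
  refine h.trans (contMDiffOn_congr fun x hx ↦ ?_)
  exact trivializationAt_snd hx _

lemma contDiffOn_chart_iff {G : Type*} [NormedAddCommGroup G] [NormedSpace ℝ G] {f : M → G}
    (c : M) : ContMDiffOn (𝓡 d) 𝓘(ℝ, G) ∞ f (chartAt 𝔼 c).source ↔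
      ContDiffOn ℝ ∞ (f ∘ (extChartAt (𝓡 d) c).symm) (extChartAt (𝓡 d) c).target := by
  rw [← contMDiffOn_iff_contDiffOn]
  constructor
  · intro h
    refine h.comp (contMDiffOn_extChartAt_symm c) fun y hy ↦ ?_
    simpa using (extChartAt (𝓡 d) c).map_target hy
  · intro h
    refine (h.comp (contMDiffOn_extChartAt (I := 𝓡 d) (x := c)) fun x hx ↦ ?_).congr
      fun x hx ↦ ?_
    · exact (extChartAt (𝓡 d) c).map_source (by simpa using hx)
    · exact (congrArg f ((extChartAt (𝓡 d) c).left_inv (by simpa using hx))).symm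

lemma contDiffOn_chartVec {X : (x : M) → TangentSpace (𝓡 d) x}
    (hX : ContMDiff (𝓡 d) (𝓡 d).tangent ∞ (fun x ↦ (⟨x, X x⟩ : TangentBundle (𝓡 d) M))) (c : M) :
    ContDiffOn ℝ ∞ (chartVec X c) (extChartAt (𝓡 d) c).target :=
  (contDiffOn_chart_iff c).1 ((contMDiffOn_vectorField_iff c).1 hX.contMDiffOn)

lemma contMDiff_of_chartVec {X : (x : M) → TangentSpace (𝓡 d) x}
    (h : ∀ c, ContDiffOn ℝ ∞ (chartVec X c) (extChartAt (𝓡 d) c).target) :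
    ContMDiff (𝓡 d) (𝓡 d).tangent ∞ (fun x ↦ (⟨x, X x⟩ : TangentBundle (𝓡 d) M)) := by
  intro c
  have := (contMDiffOn_vectorField_iff (X := X) c).2 ((contDiffOn_chart_iff c).2 (h c))
  exact this.contMDiffAt ((chartAt 𝔼 c).open_source.mem_nhds (mem_chart_source _ c))

/-- The coefficients of a smooth 1-form in a chart are smooth: evaluate the form on the local frame
of the tangent bundle given by the trivialization at `c`. -/
lemma contDiffOn_chartForm (α : OneForm d M) (c : M) :
    ContDiffOn ℝ ∞ (chartForm α c) (extChartAt (𝓡 d) c).target := by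
  refine contDiffOn_clm_apply.2 fun u ↦ ?_
  classical
  let V : (x : M) → TangentSpace (𝓡 d) x := fun x ↦
    (trivializationAt 𝔼 (TangentSpace (𝓡 d) : M → Type) c).symmL ℝ x u
  have hV : ContMDiffOn (𝓡 d) (𝓡 d).tangent ∞ (fun x ↦ (⟨x, V x⟩ : TangentBundle (𝓡 d) M))
      (chartAt 𝔼 c).source := by
    rw [contMDiffOn_vectorField_iff]
    refine contMDiffOn_const (c := u) |>.congr fun x hx ↦ ?_
    rw [← trivializationAt_snd hx]
    have hb : x ∈ (trivializationAt 𝔼 (TangentSpace (𝓡 d) : M → Type) c).baseSet := by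
      simpa using hx
    have := (trivializationAt 𝔼 (TangentSpace (𝓡 d) : M → Type) c).apply_mk_symm hb u
    rw [← Bundle.Trivialization.symmL_apply (R := ℝ) _ hb] at this
    exact congrArg Prod.snd this
  have h := ContMDiffOn.clm_bundle_apply (E₂ := fun _ : M ↦ ℝ) (F₂ := ℝ)
    (α.contMDiff.contMDiffOn (s := (chartAt 𝔼 c).source)) hV
  have h2 : ContMDiffOn (𝓡 d) 𝓘(ℝ, ℝ) ∞ (fun x ↦ α x (V x)) (chartAt 𝔼 c).source := by
    intro x hx
    have := h x hx
    rw [Bundle.contMDiffWithinAt_section] at this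
    exact this
  refine ((contDiffOn_chart_iff c).1 h2).congr fun y hy ↦ ?_
  have hx : (extChartAt (𝓡 d) c).symm y ∈ (chartAt 𝔼 c).source := by
    simpa using (extChartAt (𝓡 d) c).map_target hy
  have h3 := TangentBundle.symmL_trivializationAt (I := 𝓡 d) hx
  rw [(extChartAt (𝓡 d) c).right_inv hy, range_euclidean_model, mfderivWithin_univ] at h3
  simp only [Function.comp_apply, V, h3]
  rfl

omit [IsManifold (𝓡 d) ∞ M] in
lemma chart_target_mem_nhds {c : M} {y : 𝔼} (hy : y ∈ (extChartAt (𝓡 d) c).target) :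
    (extChartAt (𝓡 d) c).target ∈ 𝓝 y :=
  (isOpen_extChartAt_target c).mem_nhds hy

lemma mdifferentiableAt_chartSymm {c : M} {y : 𝔼} (hy : y ∈ (extChartAt (𝓡 d) c).target) :
    MDifferentiableAt 𝓘(ℝ, 𝔼) (𝓡 d) (extChartAt (𝓡 d) c).symm y :=
  ((contMDiffOn_extChartAt_symm (I := 𝓡 d) (n := ∞) c).contMDiffAt
    (chart_target_mem_nhds hy)).mdifferentiableAt (by simp)

lemma mdifferentiableAt_chart {c x : M} (hx : x ∈ (extChartAt (𝓡 d) c).source) :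
    MDifferentiableAt (𝓡 d) 𝓘(ℝ, 𝔼) (extChartAt (𝓡 d) c) x :=
  mdifferentiableAt_extChartAt (by simpa using hx)

lemma extD_eq_dForm_self (α : OneForm d M) (x : M) (v w : TangentSpace (𝓡 d) x) :
    extD α x ![v, w] =
      dForm (chartForm α x) (extChartAt (𝓡 d) x x) (dChart x x v) (dChart x x w) := by
  have ha : DifferentiableAt ℝ (chartForm α x) (extChartAt (𝓡 d) x x) :=
    ((contDiffOn_chartForm α x).contDiffAt (chart_target_mem_nhds
      (mem_extChartAt_target x))).differentiableAt (by simp)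
  exact extDeriv_ofSubsingleton ha _

/-- Naturality of the exterior derivative, in arbitrary charts. -/
lemma dForm_chartForm_pullback {α α' : (x : M) → TangentSpace (𝓡 d) x →L[ℝ] ℝ}
    {φ : M → M} {x c c' : M}
    (hα : ContDiffOn ℝ ∞ (chartForm α c') (extChartAt (𝓡 d) c').target)
    (hφ : ContMDiff (𝓡 d) (𝓡 d) ∞ φ) (hα' : IsPullback φ α α')
    (hx : x ∈ (extChartAt (𝓡 d) c).source) (hx' : φ x ∈ (extChartAt (𝓡 d) c').source)
    (v w : TangentSpace (𝓡 d) x) :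
    dForm (chartForm α' c) (extChartAt (𝓡 d) c x) (dChart c x v) (dChart c x w) =
      dForm (chartForm α c') (extChartAt (𝓡 d) c' (φ x))
        (dChart c' (φ x) (mfderiv (𝓡 d) (𝓡 d) φ x v))
        (dChart c' (φ x) (mfderiv (𝓡 d) (𝓡 d) φ x w)) := by
  obtain ⟨y, hy, rfl⟩ : ∃ y ∈ (extChartAt (𝓡 d) c).target, (extChartAt (𝓡 d) c).symm y = x :=
    ⟨_, (extChartAt (𝓡 d) c).map_source hx, (extChartAt (𝓡 d) c).left_inv hx⟩
  rw [(extChartAt (𝓡 d) c).right_inv hy]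
  let g : 𝔼 → 𝔼 := fun z ↦ extChartAt (𝓡 d) c' (φ ((extChartAt (𝓡 d) c).symm z))
  -- near `y` the chart expression `g` of `φ` is smooth, with the expected derivative
  have hev : ∀ᶠ z in 𝓝 y, z ∈ (extChartAt (𝓡 d) c).target ∧
      φ ((extChartAt (𝓡 d) c).symm z) ∈ (extChartAt (𝓡 d) c').source := by
    refine Filter.Eventually.and (chart_target_mem_nhds hy) ?_
    have : ContinuousAt (fun z ↦ φ ((extChartAt (𝓡 d) c).symm z)) y :=
      hφ.continuous.continuousAt.comp (mdifferentiableAt_chartSymm hy).continuousAt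
    exact this.eventually_mem ((isOpen_extChartAt_source c').mem_nhds hx')
  have hder (z : 𝔼) (hz : z ∈ (extChartAt (𝓡 d) c).target)
      (hz' : φ ((extChartAt (𝓡 d) c).symm z) ∈ (extChartAt (𝓡 d) c').source) (u : 𝔼) :
      fderiv ℝ g z u = dChart c' (φ ((extChartAt (𝓡 d) c).symm z))
        (mfderiv (𝓡 d) (𝓡 d) φ ((extChartAt (𝓡 d) c).symm z) (dChartSymm c z u)) := by
    have h1 := (mdifferentiableAt_chartSymm hz).hasMFDerivAt
    have h2 := (hφ.mdifferentiableAt (x := (extChartAt (𝓡 d) c).symm z) (by simp)).hasMFDerivAt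
    have h3 := (mdifferentiableAt_chart hz').hasMFDerivAt
    let A : 𝔼 →L[ℝ] 𝔼 := (dChart c' (φ ((extChartAt (𝓡 d) c).symm z))).comp
      ((mfderiv (𝓡 d) (𝓡 d) φ ((extChartAt (𝓡 d) c).symm z)).comp (dChartSymm c z))
    have h4 : HasMFDerivAt 𝓘(ℝ, 𝔼) 𝓘(ℝ, 𝔼) g z A := h3.comp z (h2.comp z h1)
    have h5 : HasFDerivAt g A z := hasMFDerivAt_iff_hasFDerivAt.1 h4
    rw [h5.fderiv]
    rfl
  have hg : ContDiffAt ℝ 2 g y := by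
    rw [← contMDiffAt_iff_contDiffAt]
    have h1 : ContMDiffAt 𝓘(ℝ, 𝔼) (𝓡 d) ∞ (extChartAt (𝓡 d) c).symm y :=
      (contMDiffOn_extChartAt_symm (I := 𝓡 d) (n := ∞) c).contMDiffAt (chart_target_mem_nhds hy)
    have h3 : ContMDiffAt (𝓡 d) 𝓘(ℝ, 𝔼) ∞ (extChartAt (𝓡 d) c')
        (φ ((extChartAt (𝓡 d) c).symm y)) :=
      contMDiffAt_extChartAt' (by simpa using hx')
    exact (h3.comp y (hφ.contMDiffAt.comp y h1)).of_le
      (WithTop.coe_le_coe.2 (le_top : (2 : ℕ∞) ≤ ⊤))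
  have hform : chartForm α' c =ᶠ[𝓝 y] fun z ↦ (chartForm α c' (g z)).comp (fderiv ℝ g z) := by
    filter_upwards [hev] with z ⟨hz, hz'⟩
    ext u
    rw [chartForm_apply, hα', ContinuousLinearMap.comp_apply, ContinuousLinearMap.comp_apply,
      hder z hz hz', chartForm_dChart α hz']
  have hgy : g y ∈ (extChartAt (𝓡 d) c').target := (extChartAt (𝓡 d) c').map_source hx'
  have ha : DifferentiableAt ℝ (chartForm α c') (g y) :=
    (hα.contDiffAt (chart_target_mem_nhds hgy)).differentiableAt (by simp)
  rw [dForm_congr hform, dForm_pullback ha hg, hder y hy hx', hder y hy hx',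
    dChartSymm_dChart hy, dChartSymm_dChart hy]

omit [IsManifold (𝓡 d) ∞ M] in
lemma isPullback_id (α : (x : M) → TangentSpace (𝓡 d) x →L[ℝ] ℝ) : IsPullback id α α := by
  intro x
  rw [mfderiv_id]
  rfl

/-- The exterior derivative can be computed in any chart. -/
lemma extD_eq_dForm (α : OneForm d M) {c x : M} (hx : x ∈ (extChartAt (𝓡 d) c).source)
    (v w : TangentSpace (𝓡 d) x) :
    extD α x ![v, w] =
      dForm (chartForm α c) (extChartAt (𝓡 d) c x) (dChart c x v) (dChart c x w) := by
  rw [extD_eq_dForm_self]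
  have := dForm_chartForm_pullback (contDiffOn_chartForm α c) contMDiff_id
    (isPullback_id (⇑α)) (mem_extChartAt_source (I := 𝓡 d) x) hx v w
  rwa [mfderiv_id] at this

lemma extD_pullback {α α' : OneForm d M} {φ : M → M} (hφ : ContMDiff (𝓡 d) (𝓡 d) ∞ φ)
    (h : IsPullback φ α α') (x : M) (v w : TangentSpace (𝓡 d) x) :
    extD α' x ![v, w] =
      extD α (φ x) ![mfderiv (𝓡 d) (𝓡 d) φ x v, mfderiv (𝓡 d) (𝓡 d) φ x w] := by
  rw [extD_eq_dForm_self, extD_eq_dForm_self]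
  exact dForm_chartForm_pullback (contDiffOn_chartForm α _) hφ h (mem_extChartAt_source x)
    (mem_extChartAt_source _) v w

lemma extD_add_smul (α β : OneForm d M) (t : ℝ) (x : M) (v w : TangentSpace (𝓡 d) x) :
    extD ⇑(α + t • β) x ![v, w] = extD α x ![v, w] + t * extD β x ![v, w] := by
  have hd (α : OneForm d M) : DifferentiableAt ℝ (chartForm α x) (extChartAt (𝓡 d) x x) :=
    ((contDiffOn_chartForm α x).contDiffAt (chart_target_mem_nhds
      (mem_extChartAt_target x))).differentiableAt (by simp)
  have h : chartForm ⇑(α + t • β) x = fun y ↦ chartForm α x y + t • chartForm β x y := by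
    ext y u
    rfl
  rw [extD_eq_dForm_self, extD_eq_dForm_self, extD_eq_dForm_self, h]
  have h2 := ((hd α).hasFDerivAt.add ((hd β).hasFDerivAt.const_smul t)).fderiv
  simp only [dForm_apply]
  erw [h2]
  simp
  ring

end Charts

/-! ### Flows on closed manifolds -/

section Flow

open Set Topology _root_.Filter

variable {d : ℕ} {M : Type*} [TopologicalSpace M] [ChartedSpace (EuclideanSpace ℝ (Fin d)) M]
  [IsManifold (𝓡 d) ∞ M] {X : (x : M) → TangentSpace (𝓡 d) x}

local notation "𝔼" => EuclideanSpace ℝ (Fin d)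

/-- A vector field that is smooth on an open set agrees near each point of this set with a smooth
bounded vector field on the whole space. -/
lemma exists_contDiff_bounded_extension {U : Set 𝔼} (hU : IsOpen U) {ξ : 𝔼 → 𝔼}
    (hξ : ContDiffOn ℝ ∞ ξ U) {y₀ : 𝔼} (hy₀ : y₀ ∈ U) :
    ∃ (f : 𝔼 → 𝔼) (C r : ℝ), ContDiff ℝ ∞ f ∧ (∀ y, ‖f y‖ ≤ C) ∧ 0 < r ∧
      Metric.ball y₀ r ⊆ U ∧ ∀ y ∈ Metric.ball y₀ r, f y = ξ y := by
  obtain ⟨R, hR, hRU⟩ := Metric.nhds_basis_closedBall.mem_iff.1 (hU.mem_nhds hy₀)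
  let χ : ContDiffBump y₀ := ⟨R / 2, R, by positivity, by linarith⟩
  have hf : ContDiff ℝ ∞ (fun y ↦ χ y • ξ y) := by
    rw [contDiff_iff_contDiffAt]
    intro y
    by_cases hy : y ∈ Metric.closedBall y₀ R
    · exact χ.contDiff.contDiffAt.smul (hξ.contDiffAt (hU.mem_nhds (hRU hy)))
    · have : (fun y ↦ χ y • ξ y) =ᶠ[𝓝 y] fun _ ↦ 0 := by
        filter_upwards [Metric.isClosed_closedBall.isOpen_compl.mem_nhds hy] with z hz
        rw [χ.zero_of_le_dist (le_of_not_ge fun h ↦ hz (Metric.mem_closedBall.2 h)), zero_smul]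
      exact contDiffAt_const.congr_of_eventuallyEq this
  have hcs : HasCompactSupport (fun y ↦ χ y • ξ y) := χ.hasCompactSupport.smul_right
  obtain ⟨C, hC⟩ := hf.continuous.bounded_above_of_compact_support hcs
  refine ⟨_, C, R / 2, hf, hC, by positivity, ?_, fun y hy ↦ ?_⟩
  · exact (Metric.ball_subset_closedBall.trans
      (Metric.closedBall_subset_closedBall (by linarith))).trans hRU
  · rw [χ.one_of_mem_closedBall (Metric.ball_subset_closedBall hy), one_smul]

/-- A smooth vector field has a smooth local flow near each point. -/
lemma exists_localFlow
    (hX : ContMDiff (𝓡 d) (𝓡 d).tangent ∞ (fun x ↦ (⟨x, X x⟩ : TangentBundle (𝓡 d) M)))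
    (x₀ : M) : ∃ ε > (0 : ℝ), ∃ Φ : ℝ → M → M,
      ContMDiffAt (𝓘(ℝ, ℝ).prod (𝓡 d)) (𝓡 d) ∞ (fun p : ℝ × M ↦ Φ p.1 p.2) (0, x₀) ∧
      ∀ᶠ x in 𝓝 x₀, Φ 0 x = x ∧ IsMIntegralCurveOn (fun t ↦ Φ t x) X (Ioo (-ε) ε) := by
  set e := extChartAt (𝓡 d) x₀
  set y₀ := e x₀
  have hy₀ : y₀ ∈ e.target := mem_extChartAt_target x₀
  obtain ⟨f, C, r, hf, hC, hr, hrU, hfξ⟩ := exists_contDiff_bounded_extension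
    (isOpen_extChartAt_target x₀) (contDiffOn_chartVec hX x₀) hy₀
  have hC0 : 0 ≤ C := (norm_nonneg _).trans (hC y₀)
  obtain ⟨r', hr', ε', hε', hσ⟩ := (hf.contDiffAt (x := y₀)).of_le
    (WithTop.coe_le_coe.2 (le_top : (1 : ℕ∞) ≤ ⊤))
    |>.exists_forall_mem_closedBall_exists_eq_forall_mem_Ioo_hasDerivAt 0
  choose! σ hσ0 hσ using hσ
  obtain ⟨ε, hε, hεε', hεC⟩ : ∃ ε > 0, ε ≤ ε' ∧ C * ε ≤ r / 2 := by
    refine ⟨min ε' (r / (2 * (C + 1))), by positivity, min_le_left _ _, ?_⟩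
    calc C * min ε' (r / (2 * (C + 1))) ≤ (C + 1) * (r / (2 * (C + 1))) := by
          gcongr
          · linarith
          · exact min_le_right _ _
      _ = r / 2 := by field_simp
  have hσ' (y : 𝔼) (hy : y ∈ Metric.closedBall y₀ r') (t : ℝ) (ht : t ∈ Ioo (-ε) ε) :
      HasDerivAt (σ y) (f (σ y t)) t :=
    hσ y hy t ⟨by linarith [ht.1], by linarith [ht.2]⟩
  have hball (y : 𝔼) (hy : y ∈ Metric.closedBall y₀ r') (hy' : y ∈ Metric.ball y₀ (r / 2)) (t : ℝ)
      (ht : t ∈ Ioo (-ε) ε) : σ y t ∈ Metric.ball y₀ r := by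
    have h := (convex_Ioo (-ε) ε).norm_image_sub_le_of_norm_hasDerivWithin_le (f := σ y)
      (fun s hs ↦ (hσ' y hy s hs).hasDerivWithinAt) (fun s _ ↦ hC _)
      (show (0 : ℝ) ∈ Ioo (-ε) ε from ⟨by linarith, hε⟩) ht
    rw [hσ0 y hy, sub_zero, Real.norm_eq_abs] at h
    have h2 : C * |t| ≤ r / 2 := (mul_le_mul_of_nonneg_left (abs_lt.2 ht).le hC0).trans hεC
    rw [Metric.mem_ball, dist_eq_norm] at hy' ⊢
    calc ‖σ y t - y₀‖ = ‖(σ y t - y) + (y - y₀)‖ := by rw [sub_add_sub_cancel]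
      _ ≤ ‖σ y t - y‖ + ‖y - y₀‖ := norm_add_le _ _
      _ < r := by linarith
  refine ⟨ε, hε, fun t x ↦ e.symm (σ (e x) t), ?_, ?_⟩
  · have h1 : ContDiffAt ℝ ∞ (fun p : ℝ × 𝔼 ↦ σ p.2 p.1) (0, y₀) := by
      refine contDiffAt_localFlow (σ := fun t y ↦ σ y t) hf hC hε ?_
      filter_upwards [Metric.closedBall_mem_nhds y₀ hr'] with y hy
      exact ⟨hσ0 y hy, hσ' y hy⟩
    have h2 : ContMDiffAt 𝓘(ℝ, 𝔼) (𝓡 d) ∞ e.symm (σ y₀ 0) := by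
      rw [hσ0 y₀ (Metric.mem_closedBall_self hr'.le)]
      exact (contMDiffOn_extChartAt_symm x₀).contMDiffAt (chart_target_mem_nhds hy₀)
    have h3 : ContMDiffAt (𝓘(ℝ, ℝ).prod (𝓡 d)) 𝓘(ℝ, ℝ × 𝔼) ∞
        (fun p : ℝ × M ↦ (p.1, e p.2)) (0, x₀) := by
      rw [modelWithCornersSelf_prod, ← chartedSpaceSelf_prod]
      refine contMDiffAt_fst.prodMk ?_
      exact (contMDiffAt_extChartAt (x := x₀)).comp _ contMDiffAt_snd
    have h4 : ContMDiffAt (𝓘(ℝ, ℝ).prod (𝓡 d)) 𝓘(ℝ, 𝔼) ∞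
        (fun p : ℝ × M ↦ σ (e p.2) p.1) (0, x₀) :=
      ContMDiffAt.comp (I' := 𝓘(ℝ, ℝ × 𝔼)) (g := fun p : ℝ × 𝔼 ↦ σ p.2 p.1)
        (f := fun p : ℝ × M ↦ (p.1, e p.2)) (0, x₀) h1.contMDiffAt h3
    exact ContMDiffAt.comp (g := e.symm) (f := fun p : ℝ × M ↦ σ (e p.2) p.1) (0, x₀) h2 h4
  · have hc : ContinuousAt e x₀ := continuousAt_extChartAt x₀
    filter_upwards [extChartAt_source_mem_nhds (I := 𝓡 d) x₀,
      hc.eventually_mem (Metric.closedBall_mem_nhds y₀ hr'),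
      hc.eventually_mem (Metric.ball_mem_nhds y₀ (half_pos hr))] with x hx h1 h2
    refine ⟨by rw [hσ0 _ h1, e.left_inv hx], fun t ht ↦ HasMFDerivAt.hasMFDerivWithinAt ?_⟩
    have hmem := hball _ h1 h2 t ht
    have h3 := (mdifferentiableAt_chartSymm (d := d) (c := x₀) (hrU hmem)).hasMFDerivAt
    have h4 := (hσ' _ h1 t ht).hasFDerivAt.hasMFDerivAt
    have h5 := h3.comp t h4
    have h6 := dChartSymm_chartVec X (c := x₀) (hrU hmem)
    rw [← hfξ _ hmem] at h6
    refine h5.congr_mfderiv (ContinuousLinearMap.ext_ring ?_)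
    refine Eq.trans ?_ (h6.trans (one_smul ℝ _).symm)
    exact congrArg (dChartSymm x₀ (σ (e x) t)) (one_smul ℝ _)

/-- `Φ` is the flow of the vector field `X`: a smooth one-parameter group of transformations whose
trajectories are the integral curves of `X`. -/
structure IsFlow (X : (x : M) → TangentSpace (𝓡 d) x) (Φ : ℝ → M → M) : Prop where
  contMDiff : ContMDiff (𝓘(ℝ, ℝ).prod (𝓡 d)) (𝓡 d) ∞ (fun p : ℝ × M ↦ Φ p.1 p.2)
  zero (x : M) : Φ 0 x = x
  add (s t : ℝ) (x : M) : Φ (s + t) x = Φ s (Φ t x)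
  isMIntegralCurve (x : M) : IsMIntegralCurve (fun t ↦ Φ t x) X

variable [T2Space M] [CompactSpace M]

/-- A smooth vector field on a closed manifold has a global smooth flow. Compactness gives local
flows on a uniform time interval; integral curves are then global, and smoothness at time zero
spreads to all times by the group property. -/
theorem exists_isFlow
    (hX : ContMDiff (𝓡 d) (𝓡 d).tangent ∞ (fun x ↦ (⟨x, X x⟩ : TangentBundle (𝓡 d) M))) :
    ∃ Φ : ℝ → M → M, IsFlow X Φ := by
  have hX1 : ContMDiff (𝓡 d) (𝓡 d).tangent 1 (fun x ↦ (⟨x, X x⟩ : TangentBundle (𝓡 d) M)) :=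
    hX.of_le (WithTop.coe_le_coe.2 (le_top : (1 : ℕ∞) ≤ ⊤))
  choose ε hε Ψ hΨ hΨ' using exists_localFlow hX
  obtain ⟨δ, hδ, hδ'⟩ : ∃ δ > (0 : ℝ), ∀ x : M, ∃ γ : ℝ → M,
      γ 0 = x ∧ IsMIntegralCurveOn γ X (Ioo (-δ) δ) := by
    obtain ⟨s, -, hs⟩ := isCompact_univ.elim_nhds_subcover
      (fun c : M ↦ {x | Ψ c 0 x = x ∧ IsMIntegralCurveOn (fun t ↦ Ψ c t x) X (Ioo (-ε c) (ε c))})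
      (fun c _ ↦ hΨ' c)
    rcases s.eq_empty_or_nonempty with rfl | hne
    · refine ⟨1, one_pos, fun x ↦ ?_⟩
      simpa using hs (mem_univ x)
    · refine ⟨s.inf' hne ε, (Finset.lt_inf'_iff _).2 fun c _ ↦ hε c, fun x ↦ ?_⟩
      obtain ⟨c, hc, hx⟩ := mem_iUnion₂.1 (hs (mem_univ x))
      have hle := s.inf'_le ε hc
      exact ⟨_, hx.1, hx.2.mono (Ioo_subset_Ioo (by linarith) hle)⟩
  choose γ hγ0 hγ using exists_isMIntegralCurve_of_isMIntegralCurveOn hX1 hδ hδ'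
  have hadd (s t : ℝ) (x : M) : γ x (s + t) = γ (γ x t) s := by
    have h1 : IsMIntegralCurve (γ x ∘ (· + t)) X := (hγ x).comp_add t
    have h2 := isMIntegralCurve_Ioo_eq_of_contMDiff_boundaryless (t₀ := 0) hX1 h1 (hγ (γ x t))
      (by simp [hγ0])
    exact congrFun h2 s
  -- smoothness at time zero
  have hzero (x : M) : ContMDiffAt (𝓘(ℝ, ℝ).prod (𝓡 d)) (𝓡 d) ∞
      (fun p : ℝ × M ↦ γ p.2 p.1) (0, x) := by
    refine (hΨ x).congr_of_eventuallyEq ?_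
    have ht : ∀ᶠ t in 𝓝 (0 : ℝ), t ∈ Ioo (-ε x) (ε x) :=
      Ioo_mem_nhds (by linarith [hε x]) (hε x)
    filter_upwards [ht.prod_nhds (hΨ' x)] with ⟨t, y⟩ ⟨ht, hy0, hy⟩
    exact isMIntegralCurveOn_Ioo_eqOn_of_contMDiff_boundaryless (t₀ := 0)
      ⟨by linarith [hε x], hε x⟩ hX1 ((hγ y).isMIntegralCurveOn _) hy
      ((hγ0 y).trans hy0.symm) ht
  refine ⟨fun t x ↦ γ x t, contMDiff_infty.2 fun k ↦ ?_, hγ0, hadd, hγ⟩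
  have hk : ((k : ℕ∞) : ℕ∞ω) ≤ ∞ := WithTop.coe_le_coe.2 le_top
  have : IsManifold (𝓡 d) k M := IsManifold.of_le hk
  let S : Set (ℝ × M) := {p | ContMDiffAt (𝓘(ℝ, ℝ).prod (𝓡 d)) (𝓡 d) k
    (fun p : ℝ × M ↦ γ p.2 p.1) p}
  obtain ⟨η, hη, hηS⟩ : ∃ η > (0 : ℝ), ∀ t, |t| < η → ∀ x, (t, x) ∈ S := by
    have h := (isCompact_univ (X := M)).eventually_forall_of_forall_eventually
      (x₀ := (0 : ℝ)) (P := fun t x ↦ (t, x) ∈ S) fun x _ ↦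
        (contMDiffAt_iff_contMDiffAt_nhds (by simp)).1 (((hzero x).of_le hk))
    obtain ⟨η, hη, h⟩ := Metric.eventually_nhds_iff_ball.1 h
    exact ⟨η, hη, fun t ht x ↦ h t (by simpa using ht) x (mem_univ x)⟩
  have hstep (t h : ℝ) (ht : ∀ x, (t, x) ∈ S) (hh : |h| < η) (x : M) : (t + h, x) ∈ S := by
    have h1 : ContMDiffAt (𝓡 d) (𝓡 d) k (fun y ↦ γ y t) x :=
      ContMDiffAt.comp (f := fun y : M ↦ (t, y)) x (ht x) (contMDiffAt_const.prodMk contMDiffAt_id)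
    have h2 : ContMDiffAt (𝓘(ℝ, ℝ).prod (𝓡 d)) (𝓘(ℝ, ℝ).prod (𝓡 d)) k
        (fun p : ℝ × M ↦ (p.1 - t, γ p.2 t)) (t + h, x) := by
      refine ContMDiffAt.prodMk ?_
        (ContMDiffAt.comp (g := fun y ↦ γ y t) (t + h, x) h1 contMDiffAt_snd)
      exact contMDiffAt_fst.sub contMDiffAt_const
    have h3 : ContMDiffAt (𝓘(ℝ, ℝ).prod (𝓡 d)) (𝓡 d) k (fun p : ℝ × M ↦ γ p.2 p.1)
        (t + h - t, γ x t) := by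
      rw [add_sub_cancel_left]
      exact hηS h hh _
    have h4 := ContMDiffAt.comp (g := fun p : ℝ × M ↦ γ p.2 p.1) (t + h, x) h3 h2
    refine h4.congr_of_eventuallyEq (Eventually.of_forall fun p ↦ ?_)
    simp [← hadd]
  rintro ⟨t, x⟩
  obtain ⟨N, hN⟩ := exists_nat_gt (|t| / η)
  have hN0 : (0 : ℝ) < N := (by positivity : 0 ≤ |t| / η).trans_lt hN
  have hind (m : ℕ) : ∀ x, ((m : ℝ) * (t / N), x) ∈ S := by
    induction m with
    | zero => intro x; simpa using hηS 0 (by simpa using hη) x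
    | succ m ih =>
      intro x
      have := hstep _ (t / N) ih (by
        rw [abs_div, abs_of_pos hN0, div_lt_iff₀ hN0, mul_comm]
        exact (div_lt_iff₀ hη).1 hN) x
      convert this using 2
      push_cast
      ring
  have := hind N x
  rwa [mul_div_cancel₀ _ hN0.ne'] at this

end Flow

/-! ### The Lie derivative of a 1-form along a flow -/

section LieDerivative

open Set Topology _root_.Filter

/-- Cartan's formula in a vector space, for a 1-form `b` that vanishes on the generator `ξ` of the
local flow `ψ`: the Lie derivative of `b` is the contraction of `db` with `ξ`. -/
lemma hasDerivAt_pullback_localFlow {E : Type*} [NormedAddCommGroup E] [NormedSpace ℝ E]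
    {ψ : ℝ × E → E} {b : E → E →L[ℝ] ℝ} {ξ : E → E} {y₀ : E}
    (hψ : ContDiffAt ℝ 2 ψ (0, y₀)) (h0 : ∀ᶠ y in 𝓝 y₀, ψ (0, y) = y)
    (hd : ∀ᶠ y in 𝓝 y₀, HasDerivAt (fun h ↦ ψ (h, y)) (ξ y) 0)
    (hb : DifferentiableAt ℝ b y₀) (hbξ : ∀ᶠ y in 𝓝 y₀, b y (ξ y) = 0) (u : E) :
    HasDerivAt (fun h ↦ b (ψ (h, y₀)) (fderiv ℝ ψ (h, y₀) (0, u))) (dForm b y₀ (ξ y₀) u) 0 := by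
  have hψ0 : ψ (0, y₀) = y₀ := h0.self_of_nhds
  have hψ1 : ∀ᶠ p in 𝓝 ((0 : ℝ), y₀), DifferentiableAt ℝ ψ p :=
    (hψ.eventually (by simp)).mono fun p hp ↦ hp.differentiableAt (by simp)
  have hψ2 : DifferentiableAt ℝ (fderiv ℝ ψ) (0, y₀) :=
    (hψ.fderiv_right (m := 1) (by norm_num)).differentiableAt (by simp)
  have hline : HasDerivAt (fun h : ℝ ↦ (h, y₀)) ((1 : ℝ), (0 : E)) 0 :=
    (hasDerivAt_id 0).prodMk (hasDerivAt_const 0 y₀)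
  have hslice : HasFDerivAt (fun y : E ↦ ((0 : ℝ), y)) (ContinuousLinearMap.inr ℝ ℝ E) y₀ :=
    hasFDerivAt_prodMk_right _ _
  -- the derivative of `ξ`, from the symmetry of the second derivative of `ψ`
  have hξeq : ∀ᶠ y in 𝓝 y₀, ξ y = fderiv ℝ ψ (0, y) (1, 0) := by
    have hc : ContinuousAt (fun y : E ↦ ((0 : ℝ), y)) y₀ := hslice.continuousAt
    filter_upwards [hc.eventually hψ1, hd] with y h1 h2
    have h3 : HasDerivAt (fun h ↦ ψ (h, y)) (fderiv ℝ ψ (0, y) (1, 0)) 0 :=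
      HasFDerivAt.comp_hasDerivAt (l := ψ) (f := fun h : ℝ ↦ (h, y)) 0 h1.hasFDerivAt
        ((hasDerivAt_id 0).prodMk (hasDerivAt_const 0 y))
    exact h2.unique h3
  have hξ : HasFDerivAt ξ (((ContinuousLinearMap.apply ℝ E ((1 : ℝ), (0 : E))).comp
      (fderiv ℝ (fderiv ℝ ψ) (0, y₀))).comp (ContinuousLinearMap.inr ℝ ℝ E)) y₀ := by
    refine HasFDerivAt.congr_of_eventuallyEq ?_ hξeq
    exact ((ContinuousLinearMap.apply ℝ E ((1 : ℝ), (0 : E))).hasFDerivAt.comp _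
      hψ2.hasFDerivAt).comp y₀ hslice
  have hsymm : fderiv ℝ (fderiv ℝ ψ) (0, y₀) (1, 0) (0, u) =
      fderiv ℝ (fderiv ℝ ψ) (0, y₀) (0, u) (1, 0) := hψ.isSymmSndFDerivAt (by simp) _ _
  -- differentiate `b(ξ) = 0`
  have hzero : fderiv ℝ b y₀ u (ξ y₀) +
      b y₀ (fderiv ℝ (fderiv ℝ ψ) (0, y₀) (0, u) (1, 0)) = 0 := by
    have h1 := (hb.hasFDerivAt.clm_apply hξ)
    have h2 : HasFDerivAt (fun y ↦ b y (ξ y)) (0 : E →L[ℝ] ℝ) y₀ :=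
      (hasFDerivAt_const (0 : ℝ) y₀).congr_of_eventuallyEq hbξ
    have h3 := congrArg (fun A ↦ A u) (h1.unique h2)
    simp at h3
    linarith
  have hu0 : fderiv ℝ ψ (0, y₀) (0, u) = u := by
    have h1 : HasFDerivAt (fun y ↦ ψ (0, y)) ((fderiv ℝ ψ (0, y₀)).comp
        (ContinuousLinearMap.inr ℝ ℝ E)) y₀ :=
      HasFDerivAt.comp (g := ψ) y₀ (hψ.differentiableAt (by simp)).hasFDerivAt hslice
    have h2 : HasFDerivAt (fun y ↦ ψ (0, y)) (ContinuousLinearMap.id ℝ E) y₀ :=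
      (hasFDerivAt_id y₀).congr_of_eventuallyEq h0
    exact congrArg (fun A ↦ A u) (h1.unique h2)
  have hA : HasDerivAt (fun h ↦ fderiv ℝ ψ (h, y₀) (0, u))
      (fderiv ℝ (fderiv ℝ ψ) (0, y₀) (1, 0) (0, u)) 0 := by
    have h1 : HasFDerivAt (fun p ↦ fderiv ℝ ψ p (0, u))
        ((ContinuousLinearMap.apply ℝ E ((0 : ℝ), u)).comp (fderiv ℝ (fderiv ℝ ψ) (0, y₀)))
        (0, y₀) :=
      (ContinuousLinearMap.apply ℝ E ((0 : ℝ), u)).hasFDerivAt.comp _ hψ2.hasFDerivAt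
    have h2 := HasFDerivAt.comp_hasDerivAt (l := fun p ↦ fderiv ℝ ψ p (0, u))
      (f := fun h : ℝ ↦ (h, y₀)) 0 h1 hline
    exact h2
  have hB : HasDerivAt (fun h ↦ b (ψ (h, y₀))) (fderiv ℝ b y₀ (ξ y₀)) 0 := by
    have hb' : HasFDerivAt b (fderiv ℝ b y₀) (ψ (0, y₀)) := by
      rw [hψ0]
      exact hb.hasFDerivAt
    exact hb'.comp_hasDerivAt (0 : ℝ) hd.self_of_nhds
  refine (hB.clm_apply hA).congr_deriv ?_
  rw [hψ0, hu0, hsymm, dForm_apply]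
  linarith

variable {d : ℕ} {M : Type*} [TopologicalSpace M] [ChartedSpace (EuclideanSpace ℝ (Fin d)) M]
  [IsManifold (𝓡 d) ∞ M] {X : (x : M) → TangentSpace (𝓡 d) x} {Φ : ℝ → M → M}

local notation "𝔼" => EuclideanSpace ℝ (Fin d)

omit [IsManifold (𝓡 d) ∞ M] in
lemma IsFlow.contMDiff_apply (hΦ : IsFlow X Φ) (t : ℝ) : ContMDiff (𝓡 d) (𝓡 d) ∞ (Φ t) :=
  hΦ.contMDiff.comp (contMDiff_const.prodMk contMDiff_id)

omit [IsManifold (𝓡 d) ∞ M] in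
lemma IsFlow.mdifferentiableAt (hΦ : IsFlow X Φ) (t : ℝ) (x : M) :
    MDifferentiableAt (𝓡 d) (𝓡 d) (Φ t) x :=
  (hΦ.contMDiff_apply t).mdifferentiableAt (by simp)

omit [IsManifold (𝓡 d) ∞ M] in
lemma IsFlow.mfderiv_add (hΦ : IsFlow X Φ) (s t : ℝ) (x : M) :
    mfderiv (𝓡 d) (𝓡 d) (Φ (s + t)) x =
      (mfderiv (𝓡 d) (𝓡 d) (Φ s) (Φ t x)).comp (mfderiv (𝓡 d) (𝓡 d) (Φ t) x) := by
  rw [← mfderiv_comp x (hΦ.mdifferentiableAt s _) (hΦ.mdifferentiableAt t x)]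
  congr 1
  exact funext (hΦ.add s t)

/-- Cartan's formula at time zero, read in the chart at the base point. -/
lemma IsFlow.hasDerivAt_pullback_zero (hΦ : IsFlow X Φ) (β : OneForm d M)
    (hβ : ∀ x, β x (X x) = 0) (x : M) (v : TangentSpace (𝓡 d) x) :
    HasDerivAt (fun h ↦ β (Φ h x) (mfderiv (𝓡 d) (𝓡 d) (Φ h) x v)) (extD β x ![X x, v]) 0 := by
  set e := extChartAt (𝓡 d) x
  set y₀ := e x
  have hy₀ : y₀ ∈ e.target := mem_extChartAt_target x
  have hxs : x ∈ e.source := mem_extChartAt_source x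
  have hinv : e.symm y₀ = x := e.left_inv hxs
  let ψ : ℝ × 𝔼 → 𝔼 := fun p ↦ e (Φ p.1 (e.symm p.2))
  have hT : ∀ᶠ y in 𝓝 y₀, y ∈ e.target := chart_target_mem_nhds hy₀
  have hψ : ContDiffAt ℝ 2 ψ (0, y₀) := by
    refine ContDiffAt.of_le (n := ∞) ?_ (WithTop.coe_le_coe.2 (le_top : (2 : ℕ∞) ≤ ⊤))
    have h1 : ContMDiffAt 𝓘(ℝ, 𝔼) (𝓡 d) ∞ e.symm y₀ :=
      (contMDiffOn_extChartAt_symm x).contMDiffAt hT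
    have h2 : ContMDiffAt (𝓘(ℝ, ℝ).prod 𝓘(ℝ, 𝔼)) (𝓘(ℝ, ℝ).prod (𝓡 d)) ∞
        (fun p : ℝ × 𝔼 ↦ (p.1, e.symm p.2)) (0, y₀) :=
      contMDiffAt_fst.prodMk (ContMDiffAt.comp (g := e.symm) (0, y₀) h1 contMDiffAt_snd)
    have h3 : ContMDiffAt (𝓡 d) 𝓘(ℝ, 𝔼) ∞ e (Φ 0 (e.symm y₀)) := by
      rw [hinv, hΦ.zero]
      exact contMDiffAt_extChartAt
    have h4 : ContMDiffAt (𝓘(ℝ, ℝ).prod 𝓘(ℝ, 𝔼)) 𝓘(ℝ, 𝔼) ∞ ψ (0, y₀) :=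
      ContMDiffAt.comp (g := e) (0, y₀) h3
        (ContMDiffAt.comp (g := fun p : ℝ × M ↦ Φ p.1 p.2) (0, y₀) hΦ.contMDiff.contMDiffAt h2)
    rw [← contMDiffAt_iff_contDiffAt, modelWithCornersSelf_prod, ← chartedSpaceSelf_prod]
    exact h4
  have h0 : ∀ᶠ y in 𝓝 y₀, ψ (0, y) = y := by
    filter_upwards [hT] with y hy
    simp only [ψ, hΦ.zero, e.right_inv hy]
  have hd : ∀ᶠ y in 𝓝 y₀, HasDerivAt (fun h ↦ ψ (h, y)) (chartVec X x y) 0 := by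
    filter_upwards [hT] with y hy
    have h1 := hΦ.isMIntegralCurve (e.symm y) 0
    have h2 : HasMFDerivAt (𝓡 d) 𝓘(ℝ, 𝔼) e (Φ 0 (e.symm y)) _ :=
      (mdifferentiableAt_chart (by rw [hΦ.zero]; exact e.map_target hy)).hasMFDerivAt
    have h3 : HasMFDerivAt 𝓘(ℝ, ℝ) 𝓘(ℝ, 𝔼) (fun h ↦ ψ (h, y)) 0
        (ContinuousLinearMap.toSpanSingleton ℝ (chartVec X x y)) := by
      refine (h2.comp 0 h1).congr_mfderiv (ContinuousLinearMap.ext_ring ?_)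
      have h4 : dChart x (Φ 0 (e.symm y)) (X (Φ 0 (e.symm y))) = chartVec X x y := by
        rw [hΦ.zero]
        rfl
      refine Eq.trans ?_ (h4.trans (one_smul ℝ _).symm)
      exact congrArg (dChart x (Φ 0 (e.symm y))) (one_smul ℝ _)
    have h5 : HasFDerivAt (fun h ↦ ψ (h, y))
        (ContinuousLinearMap.toSpanSingleton ℝ (chartVec X x y)) 0 :=
      hasMFDerivAt_iff_hasFDerivAt.1 h3
    simpa using h5.hasDerivAt
  have hb : DifferentiableAt ℝ (chartForm β x) y₀ :=
    ((contDiffOn_chartForm β x).contDiffAt hT).differentiableAt (by simp)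
  have hbξ : ∀ᶠ y in 𝓝 y₀, chartForm β x y (chartVec X x y) = 0 := by
    filter_upwards [hT] with y hy
    rw [chartForm_chartVec _ _ hy, hβ]
  have key := hasDerivAt_pullback_localFlow hψ h0 hd hb hbξ (dChart x x v)
  have hX0 : chartVec X x y₀ = dChart x x (X x) := by
    simp only [chartVec]
    erw [hinv]
  rw [hX0, ← extD_eq_dForm_self] at key
  refine key.congr_of_eventuallyEq ?_
  have hs : ∀ᶠ h in 𝓝 (0 : ℝ), Φ h x ∈ e.source := by
    have hc : ContinuousAt (fun h ↦ Φ h x) 0 := (hΦ.isMIntegralCurve x 0).continuousAt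
    refine hc.eventually_mem ((isOpen_extChartAt_source x).mem_nhds ?_)
    rw [hΦ.zero]
    exact hxs
  have hψd : ∀ᶠ h in 𝓝 (0 : ℝ), DifferentiableAt ℝ ψ (h, y₀) := by
    have hc : ContinuousAt (fun h : ℝ ↦ (h, y₀)) 0 := by fun_prop
    exact hc.eventually ((hψ.eventually (by simp)).mono fun p hp ↦ hp.differentiableAt (by simp))
  filter_upwards [hs, hψd] with h hh hψh
  have h1 : fderiv ℝ ψ (h, y₀) (0, dChart x x v) =
      dChart x (Φ h x) (mfderiv (𝓡 d) (𝓡 d) (Φ h) x v) := by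
    have h2 : HasFDerivAt (fun y ↦ ψ (h, y)) ((fderiv ℝ ψ (h, y₀)).comp
        (ContinuousLinearMap.inr ℝ ℝ 𝔼)) y₀ :=
      HasFDerivAt.comp (g := ψ) y₀ hψh.hasFDerivAt (hasFDerivAt_prodMk_right _ _)
    let A : TangentSpace (𝓡 d) x →L[ℝ] 𝔼 :=
      (dChart x (Φ h x)).comp (mfderiv (𝓡 d) (𝓡 d) (Φ h) x)
    have h3 : HasMFDerivAt (𝓡 d) 𝓘(ℝ, 𝔼) (fun z ↦ e (Φ h z)) x A :=
      (mdifferentiableAt_chart hh).hasMFDerivAt.comp x (hΦ.mdifferentiableAt h x).hasMFDerivAt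
    have h4 : HasMFDerivAt (𝓡 d) 𝓘(ℝ, 𝔼) (fun z ↦ ψ (h, e z)) x
        (((fderiv ℝ ψ (h, y₀)).comp (ContinuousLinearMap.inr ℝ ℝ 𝔼)).comp (dChart x x)) :=
      HasMFDerivAt.comp (g := fun y ↦ ψ (h, y)) x h2.hasMFDerivAt
        (mdifferentiableAt_chart hxs).hasMFDerivAt
    have h5 : (fun z ↦ ψ (h, e z)) =ᶠ[𝓝 x] fun z ↦ e (Φ h z) := by
      filter_upwards [extChartAt_source_mem_nhds (I := 𝓡 d) x] with z hz
      simp only [ψ]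
      rw [e.left_inv hz]
    have h6 := hasMFDerivAt_unique h4 (h3.congr_of_eventuallyEq h5)
    exact congrArg (fun B ↦ B v) h6
  rw [h1]
  have h7 : ψ (h, y₀) = e (Φ h x) := by simp only [ψ, hinv]
  rw [h7, chartForm_dChart _ hh]

/-- Cartan's formula for a 1-form that vanishes on the generator of a flow. -/
lemma IsFlow.hasDerivAt_pullback (hΦ : IsFlow X Φ) (β : OneForm d M)
    (hβ : ∀ x, β x (X x) = 0) (x : M) (v : TangentSpace (𝓡 d) x) (s : ℝ) :
    HasDerivAt (fun s ↦ β (Φ s x) (mfderiv (𝓡 d) (𝓡 d) (Φ s) x v))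
      (extD β (Φ s x) ![X (Φ s x), mfderiv (𝓡 d) (𝓡 d) (Φ s) x v]) s := by
  have h := hΦ.hasDerivAt_pullback_zero β hβ (Φ s x) (mfderiv (𝓡 d) (𝓡 d) (Φ s) x v)
  rw [← sub_self s] at h
  refine (h.comp_sub_const s s).congr_of_eventuallyEq (Eventually.of_forall fun r ↦ ?_)
  have h1 := hΦ.mfderiv_add (r - s) s x
  have h2 := hΦ.add (r - s) s x
  rw [sub_add_cancel] at h1 h2
  -- the two sides live in tangent spaces at equal, but not definitionally equal, points
  have h3 (y : M) (hy : Φ r x = y) (A : TangentSpace (𝓡 d) x →L[ℝ] TangentSpace (𝓡 d) y)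
      (hA : mfderiv (𝓡 d) (𝓡 d) (Φ r) x = A) :
      β (Φ r x) (mfderiv (𝓡 d) (𝓡 d) (Φ r) x v) = β y (A v) := by
    subst hy
    rw [hA]
  exact h3 _ h2 _ h1

end LieDerivative

/-! ### The bilinear form `da + a ⊗ a` and Reeb fields -/

section Duality

open Set Topology _root_.Filter

variable {E : Type*} [NormedAddCommGroup E] [NormedSpace ℝ E]

/-- The bilinear form `da + a ⊗ a` attached to a 1-form `a` on a vector space. It is nondegenerate
exactly when `a` and `da` have no common kernel. -/
def contactBilin (a : E → E →L[ℝ] ℝ) (y : E) : E →L[ℝ] E →L[ℝ] ℝ :=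
  dForm a y + (a y).smulRight (a y)

lemma contactBilin_apply (a : E → E →L[ℝ] ℝ) (y u w : E) :
    contactBilin a y u w = dForm a y u w + a y u * a y w := rfl

lemma contDiffOn_dForm [FiniteDimensional ℝ E] {a : E → E →L[ℝ] ℝ} {U : Set E} (hU : IsOpen U)
    (ha : ContDiffOn ℝ ∞ a U) : ContDiffOn ℝ ∞ (dForm a) U := by
  have h : ContDiffOn ℝ ∞ (fderiv ℝ a) U := ha.fderiv_of_isOpen hU (by simp)
  refine contDiffOn_clm_apply.2 fun u ↦ contDiffOn_clm_apply.2 fun w ↦ ?_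
  exact ((h.clm_apply contDiffOn_const).clm_apply contDiffOn_const).sub
    ((h.clm_apply contDiffOn_const).clm_apply contDiffOn_const)

lemma contDiffOn_contactBilin [FiniteDimensional ℝ E] {a : E → E →L[ℝ] ℝ} {U : Set E} (hU : IsOpen U)
    (ha : ContDiffOn ℝ ∞ a U) : ContDiffOn ℝ ∞ (contactBilin a) U :=
  (contDiffOn_dForm hU ha).add (ha.smulRight ha)

lemma contactBilin_injective {a : E → E →L[ℝ] ℝ} {y : E}
    (h : ∀ u, a y u = 0 → (∀ w, dForm a y u w = 0) → u = 0) :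
    Function.Injective (contactBilin a y) := by
  rw [injective_iff_map_eq_zero]
  intro u hu
  have h1 (w : E) : dForm a y u w + a y u * a y w = 0 := by
    rw [← contactBilin_apply, hu]
    rfl
  have h2 : a y u = 0 := by
    have := h1 u
    rw [dForm_apply, sub_self, zero_add] at this
    exact mul_self_eq_zero.1 this
  exact h u h2 fun w ↦ by simpa [h2] using h1 w

lemma exists_equiv_of_injective [FiniteDimensional ℝ E] {B : E →L[ℝ] E →L[ℝ] ℝ}
    (hB : Function.Injective B) : ∃ L : E ≃L[ℝ] (E →L[ℝ] ℝ), (L : E →L[ℝ] E →L[ℝ] ℝ) = B := by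
  have hdim : Module.finrank ℝ E = Module.finrank ℝ (E →L[ℝ] ℝ) := by
    rw [← (LinearMap.toContinuousLinearMap (𝕜 := ℝ) (E := E) (F' := ℝ)).finrank_eq]
    exact (Subspace.dual_finrank_eq (K := ℝ) (V := E)).symm
  refine ⟨(LinearEquiv.ofInjectiveOfFinrankEq B.toLinearMap hB hdim).toContinuousLinearEquiv, ?_⟩
  ext u w
  rfl

/-- A skew form on an odd-dimensional space is degenerate. -/
lemma exists_ne_zero_of_skew [FiniteDimensional ℝ E] (hE : Odd (Module.finrank ℝ E))
    {η : E →L[ℝ] E →L[ℝ] ℝ} (hη : ∀ u w, η u w = - η w u) : ∃ u ≠ 0, η u = 0 := by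
  let b := Module.finBasis ℝ E
  let A : Matrix (Fin (Module.finrank ℝ E)) (Fin (Module.finrank ℝ E)) ℝ :=
    fun i j ↦ η (b i) (b j)
  have hA : A.transpose = -A := by
    ext i j
    exact hη _ _
  have hdet : A.det = 0 := by
    have h := A.det_transpose
    rw [hA, Matrix.det_neg, Fintype.card_fin, hE.neg_one_pow] at h
    linarith
  obtain ⟨v, hv, hvA⟩ := Matrix.exists_vecMul_eq_zero_iff.2 hdet
  refine ⟨∑ i, v i • b i, fun h0 ↦ hv ?_, ?_⟩
  · exact funext (Fintype.linearIndependent_iff.1 b.linearIndependent v h0)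
  · have : (η (∑ i, v i • b i)).toLinearMap = 0 := b.ext fun j ↦ by
      have := congrFun hvA j
      simpa [Matrix.vecMul, dotProduct, A] using this
    ext w
    exact congrArg (fun f ↦ f w) this

variable {d : ℕ} {M : Type*} [TopologicalSpace M] [ChartedSpace (EuclideanSpace ℝ (Fin d)) M]
  [IsManifold (𝓡 d) ∞ M]

local notation "𝔼" => EuclideanSpace ℝ (Fin d)

/-- The kernels of `α` and `dα` meet trivially at each point. On an odd-dimensional manifold this
characterizes contact forms. -/
def HasTrivialKernel (α : (x : M) → TangentSpace (𝓡 d) x →L[ℝ] ℝ) : Prop :=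
  ∀ (x : M) (v : TangentSpace (𝓡 d) x), α x v = 0 → (∀ w, extD α x ![v, w] = 0) → v = 0

lemma contactBilin_chartForm (α : OneForm d M) {c x : M} (hx : x ∈ (extChartAt (𝓡 d) c).source)
    (v w : TangentSpace (𝓡 d) x) :
    contactBilin (chartForm α c) (extChartAt (𝓡 d) c x) (dChart c x v) (dChart c x w) =
      extD α x ![v, w] + α x v * α x w := by
  rw [contactBilin_apply, extD_eq_dForm α hx, chartForm_dChart _ hx, chartForm_dChart _ hx]

lemma contactBilin_chartForm_injective {α : OneForm d M} (hα : HasTrivialKernel ⇑α) {c : M} {y : 𝔼}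
    (hy : y ∈ (extChartAt (𝓡 d) c).target) :
    Function.Injective (contactBilin (chartForm α c) y) := by
  have hx := (extChartAt (𝓡 d) c).map_target hy
  refine contactBilin_injective fun u h1 h2 ↦ ?_
  have key := hα _ (dChartSymm c y u) h1 fun w ↦ by
    rw [extD_eq_dForm α hx, (extChartAt (𝓡 d) c).right_inv hy, dChart_dChartSymm hy]
    exact h2 _
  rw [← dChart_dChartSymm hy u, key, map_zero]

/-- If `α` and `dα` have no common kernel, every 1-form `β` is represented by a smooth vector field
through the bilinear form `dα + α ⊗ α`. -/
theorem exists_dual_vectorField {α : OneForm d M} (hα : HasTrivialKernel ⇑α) (β : OneForm d M) :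
    ∃ X : (x : M) → TangentSpace (𝓡 d) x,
      ContMDiff (𝓡 d) (𝓡 d).tangent ∞ (fun x ↦ (⟨x, X x⟩ : TangentBundle (𝓡 d) M)) ∧
      ∀ x v, extD α x ![X x, v] + α x (X x) * α x v = β x v := by
  have hpt (x : M) : ∃ X : TangentSpace (𝓡 d) x,
      ∀ v, extD α x ![X, v] + α x X * α x v = β x v := by
    have hx := mem_extChartAt_source (I := 𝓡 d) x
    obtain ⟨L, hL⟩ := exists_equiv_of_injective
      (contactBilin_chartForm_injective hα (mem_extChartAt_target (I := 𝓡 d) x))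
    obtain ⟨X, hX⟩ := (dChart_bijective hx).2
      (L.symm (chartForm β x (extChartAt (𝓡 d) x x)))
    refine ⟨X, fun v ↦ ?_⟩
    rw [← contactBilin_chartForm α hx, hX, ← hL, ContinuousLinearEquiv.coe_coe,
      L.apply_symm_apply, chartForm_dChart _ hx]
  choose X hX using hpt
  refine ⟨X, contMDiff_of_chartVec fun c ↦ ?_, hX⟩
  have hT := isOpen_extChartAt_target (I := 𝓡 d) c
  have hB := contDiffOn_contactBilin hT (contDiffOn_chartForm α c)
  have hloc : ∀ y ∈ (extChartAt (𝓡 d) c).target,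
      chartVec X c y = (contactBilin (chartForm α c) y).inverse (chartForm β c y) := by
    intro y hy
    obtain ⟨L, hL⟩ := exists_equiv_of_injective (contactBilin_chartForm_injective hα hy)
    rw [← hL, ContinuousLinearMap.inverse_equiv, ContinuousLinearEquiv.coe_coe,
      L.eq_symm_apply]
    ext u
    have hx := (extChartAt (𝓡 d) c).map_target hy
    have h := contactBilin_chartForm α hx (X _) (dChartSymm c y u)
    rw [hX, (extChartAt (𝓡 d) c).right_inv hy, dChart_dChartSymm hy, ← hL] at h
    exact h
  refine ContDiffOn.congr (fun y hy ↦ ContDiffAt.contDiffWithinAt ?_) hloc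
  obtain ⟨L, hL⟩ := exists_equiv_of_injective (contactBilin_chartForm_injective hα hy)
  have h1 : ContDiffAt ℝ ∞ ContinuousLinearMap.inverse (contactBilin (chartForm α c) y) := by
    rw [← hL]
    exact contDiffAt_map_inverse L
  exact (h1.comp y (hB.contDiffAt (hT.mem_nhds hy))).clm_apply
    ((contDiffOn_chartForm β c).contDiffAt (hT.mem_nhds hy))

lemma extD_swap (α : OneForm d M) (x : M) (v w : TangentSpace (𝓡 d) x) :
    extD α x ![v, w] = - extD α x ![w, v] := by
  rw [extD_eq_dForm_self, extD_eq_dForm_self, dForm_apply, dForm_apply, neg_sub]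

lemma extD_smul_left (α : OneForm d M) (x : M) (v w : TangentSpace (𝓡 d) x) (s : ℝ) :
    extD α x ![s • v, w] = s * extD α x ![v, w] := by
  simp only [extD_eq_dForm_self, map_smul]
  rfl

lemma eq_of_dual_eq {α : OneForm d M} (hα : HasTrivialKernel ⇑α) {x : M}
    {u v : TangentSpace (𝓡 d) x}
    (h : ∀ w, extD α x ![u, w] + α x u * α x w = extD α x ![v, w] + α x v * α x w) : u = v := by
  have hx := mem_extChartAt_source (I := 𝓡 d) x
  refine (dChart_bijective hx).1 (contactBilin_chartForm_injective hα
    (mem_extChartAt_target (I := 𝓡 d) x) (ContinuousLinearMap.ext fun y ↦ ?_))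
  obtain ⟨w, rfl⟩ := (dChart_bijective hx).2 y
  rw [contactBilin_chartForm α hx, contactBilin_chartForm α hx, h]

lemma exists_reebVector {α : OneForm d M} (hd : Odd d) (hα : HasTrivialKernel ⇑α) (x : M) :
    ∃ R : TangentSpace (𝓡 d) x, α x R = 1 ∧ ∀ w, extD α x ![R, w] = 0 := by
  have hx := mem_extChartAt_source (I := 𝓡 d) x
  obtain ⟨u, hu, hu0⟩ := exists_ne_zero_of_skew (E := 𝔼) (by simpa using hd)
    (η := dForm (chartForm α x) (extChartAt (𝓡 d) x x)) fun u w ↦ by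
      rw [dForm_apply, dForm_apply, neg_sub]
  obtain ⟨v, rfl⟩ := (dChart_bijective hx).2 u
  have hv (w : TangentSpace (𝓡 d) x) : extD α x ![v, w] = 0 := by
    rw [extD_eq_dForm_self, hu0]
    rfl
  have hα0 : α x v ≠ 0 := fun h ↦ hu (by rw [hα x v h hv, map_zero])
  refine ⟨(α x v)⁻¹ • v, ?_, fun w ↦ ?_⟩
  · rw [map_smul, smul_eq_mul, inv_mul_cancel₀ hα0]
  · rw [extD_smul_left, hv, mul_zero]

/-- Reeb fields exist for forms with trivial kernel in odd dimensions. -/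
theorem exists_isReebField {α : OneForm d M} (hd : Odd d) (hα : HasTrivialKernel ⇑α) :
    ∃ Z : (x : M) → TangentSpace (𝓡 d) x, IsReebField (⇑α) Z := by
  obtain ⟨Z, hZ, h⟩ := exists_dual_vectorField hα α
  have key (x : M) : α x (Z x) = 1 ∧ ∀ w, extD α x ![Z x, w] = 0 := by
    obtain ⟨R, hR1, hR⟩ := exists_reebVector hd hα x
    have : Z x = R := eq_of_dual_eq hα fun w ↦ by rw [h, hR, hR1, zero_add, one_mul]
    rw [this]
    exact ⟨hR1, hR⟩
  exact ⟨Z, hZ, fun x ↦ (key x).1, fun x ↦ (key x).2⟩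

/-- If `β` vanishes on the Reeb field `R` of `α`, the vector field dual to `β` lies in the kernel of
`α` and its contraction with `dα` is `β`. -/
theorem exists_contraction_eq {α β : OneForm d M} (hα : HasTrivialKernel ⇑α)
    {R : (x : M) → TangentSpace (𝓡 d) x} (hR : IsReebField (⇑α) R) (hβ : ∀ x, β x (R x) = 0) :
    ∃ X : (x : M) → TangentSpace (𝓡 d) x,
      ContMDiff (𝓡 d) (𝓡 d).tangent ∞ (fun x ↦ (⟨x, X x⟩ : TangentBundle (𝓡 d) M)) ∧
      (∀ x, α x (X x) = 0) ∧ (∀ x v, extD α x ![X x, v] = β x v) := by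
  obtain ⟨X, hX, h⟩ := exists_dual_vectorField hα β
  have h0 (x : M) : α x (X x) = 0 := by
    have := h x (R x)
    rwa [extD_swap, hR.extD_eq_zero, hR.apply_eq_one, hβ, neg_zero, zero_add, mul_one] at this
  refine ⟨X, hX, h0, fun x v ↦ ?_⟩
  have := h x v
  rwa [h0, zero_mul, add_zero] at this

end Duality

/-! ### Top-degree forms and common kernels -/

section WedgeKernel

variable {V : Type*} [AddCommGroup V] [Module ℝ V]

/-- In each summand of the exterior product, `v` is an argument of one of the two factors. -/
lemma wedge_apply_eq_zero {k l : ℕ} {a : V [⋀^Fin k]→ₗ[ℝ] ℝ} {b : V [⋀^Fin l]→ₗ[ℝ] ℝ} {v : V}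
    (ha : ∀ (x : Fin k → V) i, x i = v → a x = 0) (hb : ∀ (x : Fin l → V) i, x i = v → b x = 0)
    (x : Fin (k + l) → V) (i : Fin (k + l)) (hx : x i = v) : wedge a b x = 0 := by
  have hx' : (x ∘ finSumFinEquiv) (finSumFinEquiv.symm i) = v := by simpa using hx
  change LinearMap.mul' ℝ ℝ (a.domCoprod b (x ∘ finSumFinEquiv)) = 0
  generalize x ∘ finSumFinEquiv = x', finSumFinEquiv.symm i = j at hx'
  have h := congrArg (fun f ↦ f x') (AlternatingMap.domCoprod_coe a b)
  simp only [AlternatingMap.coe_multilinearMap, sum_apply] at h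
  rw [h, map_sum]
  refine Finset.sum_eq_zero fun σ _ ↦ ?_
  induction σ using Quotient.inductionOn' with
  | h σ =>
    rw [AlternatingMap.domCoprod.summand_mk'', smul_apply,
      MultilinearMap.domDomCongr_apply, MultilinearMap.domCoprod_apply, map_zsmul_unit,
      LinearMap.mul'_apply]
    have hj : x' (σ (σ⁻¹ j)) = v := by simpa using hx'
    cases hs : σ⁻¹ j with
    | inl p =>
      rw [hs] at hj
      rw [AlternatingMap.coe_multilinearMap, ha _ p hj, zero_mul, smul_zero]
    | inr p =>
      rw [hs] at hj
      rw [AlternatingMap.coe_multilinearMap, AlternatingMap.coe_multilinearMap, hb _ p hj,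
        mul_zero, smul_zero]

lemma wedge_add_left {k l : ℕ} (a a' : V [⋀^Fin k]→ₗ[ℝ] ℝ) (b : V [⋀^Fin l]→ₗ[ℝ] ℝ) :
    wedge (a + a') b = wedge a b + wedge a' b := by
  have : (a + a').domCoprod b = a.domCoprod b + a'.domCoprod b := by
    simp only [← AlternatingMap.domCoprod'_apply, TensorProduct.add_tmul, map_add]
  ext x
  simp [wedge, this]

lemma wedgePow_apply_eq_zero {η : V [⋀^Fin 2]→ₗ[ℝ] ℝ} {v : V}
    (hη : ∀ (x : Fin 2 → V) i, x i = v → η x = 0) :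
    ∀ (m : ℕ) (x : Fin (2 * m) → V) i, x i = v → wedgePow η m x = 0
  | 0, _, i, _ => i.elim0
  | m + 1, x, i, hx => wedge_apply_eq_zero (wedgePow_apply_eq_zero hη m) hη x i hx

/-- A top-degree form that vanishes as soon as one argument is the nonzero vector `v` is zero, since
it vanishes on a basis that contains `v`. -/
lemma eq_zero_of_forall_apply_eq_zero {N : ℕ} (hN : Module.finrank ℝ V = N + 1)
    {f : V [⋀^Fin (N + 1)]→ₗ[ℝ] ℝ} {v : V} (hv : v ≠ 0)
    (hf : ∀ (x : Fin (N + 1) → V) i, x i = v → f x = 0) : f = 0 := by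
  have : FiniteDimensional ℝ V := Module.finite_of_finrank_pos (by omega)
  have hli : LinearIndepOn ℝ id ({v} : Set V) := LinearIndepOn.singleton hv
  let b := Module.Basis.extend hli
  have hvb : v ∈ hli.extend (Set.subset_univ _) :=
    hli.subset_extend (Set.subset_univ _) rfl
  have : Fintype (hli.extend (Set.subset_univ _)) := FiniteDimensional.fintypeBasisIndex b
  have e : hli.extend (Set.subset_univ {v}) ≃ Fin (N + 1) :=
    Fintype.equivFinOfCardEq (by rw [← hN, Module.finrank_eq_card_basis b])
  rw [← AlternatingMap.map_basis_eq_zero_iff (b.reindex e)]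
  refine hf _ (e ⟨v, hvb⟩) ?_
  simp [b]

/-- The easy half of the linear characterization of contact forms: on a vector space of dimension
`2n + 1`, if `a ∧ ηⁿ ≠ 0` then `a` and `η` have no common kernel. -/
theorem eq_zero_of_wedge_ne_zero {n : ℕ} (hV : Module.finrank ℝ V = 2 * n + 1) {a : V →ₗ[ℝ] ℝ}
    {η : V [⋀^Fin 2]→ₗ[ℝ] ℝ} (h : wedge (toForm a) (wedgePow η n) ≠ 0) {v : V} (hav : a v = 0)
    (hηv : ∀ w, η ![v, w] = 0) : v = 0 := by
  by_contra hv
  have hη (x : Fin 2 → V) (i) (hi : x i = v) : η x = 0 := by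
    have hx : x = ![x 0, x 1] := List.ofFn_inj.mp rfl
    rw [hx]
    fin_cases i
    · rw [show x 0 = v from hi, hηv]
    · have := η.map_swap (v := ![x 1, x 0]) (i := 0) (j := 1) (by decide)
      have hsw : ![x 1, x 0] ∘ (Equiv.swap (0 : Fin 2) 1) = ![x 0, x 1] := by
        ext i
        fin_cases i <;> simp
      rw [hsw, show x 1 = v from hi, hηv, neg_zero] at this
      rw [show x 1 = v from hi, this]
  have ha (x : Fin 1 → V) (i) (hi : x i = v) : toForm a x = 0 := by
    rw [Subsingleton.elim i 0] at hi
    change a (x 0) = 0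
    rw [hi, hav]
  have key := wedge_apply_eq_zero ha (wedgePow_apply_eq_zero hη n)
  revert h key
  generalize wedge (toForm a) (wedgePow η n) = f
  have hn : 1 + 2 * n = 2 * n + 1 := add_comm _ _
  revert f
  rw [hn]
  exact fun f h key ↦ h (eq_zero_of_forall_apply_eq_zero hV hv key)

end WedgeKernel

section ContactKernel

variable {n : ℕ} {M : Type*} [TopologicalSpace M]
  [ChartedSpace (EuclideanSpace ℝ (Fin (2 * n + 1))) M]

lemma IsContactForm.hasTrivialKernel
    {α : (x : M) → TangentSpace (𝓡 (2 * n + 1)) x →L[ℝ] ℝ} (h : IsContactForm α) :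
    HasTrivialKernel α := fun x _ hv hw ↦
  eq_zero_of_wedge_ne_zero
    ((finrank_euclideanSpace_fin : Module.finrank ℝ (EuclideanSpace ℝ (Fin (2 * n + 1))) = _))
    (h x) hv hw

end ContactKernel

/-! ### The derivative of a determinant -/

section Jacobi

variable {ι : Type*} [Fintype ι] [DecidableEq ι]

/-- Jacobi's formula for the derivative of a determinant. -/
lemma hasFDerivAt_det {E : Type*} [NormedAddCommGroup E] [NormedSpace ℝ E] {A : E → Matrix ι ι ℝ}
    {A' : ι → ι → E →L[ℝ] ℝ} {y : E} (hA : ∀ i j, HasFDerivAt (fun z ↦ A z i j) (A' i j) y) :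
    ∃ D : E →L[ℝ] ℝ, HasFDerivAt (fun z ↦ (A z).det) D y ∧
      ∀ u, D u = ((A y).adjugate * Matrix.of fun i j ↦ A' i j u).trace := by
  let F : ContinuousMultilinearMap ℝ (fun _ : ι ↦ ι → ℝ) ℝ :=
    ⟨(Matrix.detRowAlternating (R := ℝ) (n := ι)).toMultilinearMap, by
      change Continuous fun M : ι → ι → ℝ ↦ Matrix.det M
      exact Continuous.matrix_det continuous_id⟩
  let A₀ : E → ι → ι → ℝ := A
  have h1 : HasFDerivAt A₀
      (ContinuousLinearMap.pi fun i ↦ ContinuousLinearMap.pi fun j ↦ A' i j) y :=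
    hasFDerivAt_pi.2 fun i ↦ hasFDerivAt_pi.2 fun j ↦ hA i j
  have h2 := (F.hasFDerivAt (A₀ y)).comp y h1
  refine ⟨_, h2, fun u ↦ ?_⟩
  rw [ContinuousLinearMap.comp_apply, ContinuousMultilinearMap.linearDeriv_apply]
  have key (i : ι) (b : ι → ℝ) : F (Function.update (A₀ y) i b) =
      ∑ j, (A y).adjugate j i * b j := by
    change ((A y).updateRow i b).det = _
    rw [← Matrix.cramer_transpose_apply, Matrix.cramer_eq_adjugate_mulVec,
      ← Matrix.adjugate_transpose]
    rfl
  simp only [key, Matrix.trace, Matrix.diag, Matrix.mul_apply]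
  rw [Finset.sum_comm]
  rfl

end Jacobi

/-! ### Matrices of bilinear forms -/

section Gram

variable {E : Type*} [NormedAddCommGroup E] [NormedSpace ℝ E]
  {ι : Type*} [Fintype ι] [DecidableEq ι] (b : Module.Basis ι ℝ E)

/-- The matrix of a bilinear form in a basis. -/
def gram (B : E →L[ℝ] E →L[ℝ] ℝ) : Matrix ι ι ℝ := Matrix.of fun i j ↦ B (b i) (b j)

omit [Fintype ι] [DecidableEq ι] in
lemma gram_apply (B : E →L[ℝ] E →L[ℝ] ℝ) (i j : ι) : gram b B i j = B (b i) (b j) := rfl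

lemma transpose_toMatrix_mul_gram (T : E →ₗ[ℝ] E) (B : E →L[ℝ] E →L[ℝ] ℝ) (i j : ι) :
    ((LinearMap.toMatrix b b T).transpose * gram b B) i j = B (T (b i)) (b j) := by
  conv_rhs => rw [← b.sum_repr (T (b i)), map_sum]
  simp [Matrix.mul_apply, LinearMap.toMatrix_apply, gram_apply]

lemma gram_mul_toMatrix (T : E →ₗ[ℝ] E) (B : E →L[ℝ] E →L[ℝ] ℝ) (i j : ι) :
    (gram b B * LinearMap.toMatrix b b T) i j = B (b i) (T (b j)) := by
  conv_rhs => rw [← b.sum_repr (T (b j)), map_sum]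
  simp [Matrix.mul_apply, LinearMap.toMatrix_apply, gram_apply, mul_comm]

lemma det_gram_of_comp {B C : E →L[ℝ] E →L[ℝ] ℝ} {T : E →L[ℝ] E}
    (h : ∀ u w, B u w = C (T u) (T w)) :
    (gram b B).det = T.det ^ 2 * (gram b C).det := by
  have : gram b B = (LinearMap.toMatrix b b (T : E →ₗ[ℝ] E)).transpose *
      (gram b C * LinearMap.toMatrix b b (T : E →ₗ[ℝ] E)) := by
    rw [← Matrix.mul_assoc]
    ext i j
    have h2 : (LinearMap.toMatrix b b (T : E →ₗ[ℝ] E)).transpose * gram b C =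
        gram b (C.comp T) := by
      ext i j
      exact transpose_toMatrix_mul_gram b _ _ _ _
    rw [h2, gram_mul_toMatrix, gram_apply, h]
    rfl
  rw [this, Matrix.det_mul, Matrix.det_mul, Matrix.det_transpose, LinearMap.det_toMatrix]
  change T.det * (_ * T.det) = _
  ring

lemma det_gram_ne_zero {B : E →L[ℝ] E →L[ℝ] ℝ} (hB : Function.Injective B) :
    (gram b B).det ≠ 0 := by
  intro h
  obtain ⟨v, hv, hvA⟩ := Matrix.exists_vecMul_eq_zero_iff.2 h
  refine hv (funext (Fintype.linearIndependent_iff.1 b.linearIndependent v ?_))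
  refine hB ?_
  have : (B (∑ i, v i • b i)).toLinearMap = 0 := b.ext fun j ↦ by
    have := congrFun hvA j
    simpa [Matrix.vecMul, dotProduct, gram_apply] using this
  rw [map_zero]
  ext w
  exact congrArg (fun f ↦ f w) this

open Matrix in
lemma trace_inv_mul_vecMulVec {A : Matrix ι ι ℝ} (p q : ι → ℝ) :
    (A⁻¹ * vecMulVec p q).trace = q ⬝ᵥ (A⁻¹ *ᵥ p) := by
  rw [Matrix.mul_vecMulVec, Matrix.trace_vecMulVec, dotProduct_comm]

end Gram

/-! ### The density of a 1-form and its divergence identity -/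

section Divergence

variable {E : Type*} [NormedAddCommGroup E] [NormedSpace ℝ E]
  {ι : Type*} [Fintype ι] [DecidableEq ι] (b : Module.Basis ι ℝ E)

/-- The density attached to the form `a`, relative to the basis `b`: the square root of the
absolute value of the determinant of the form `da + a ⊗ a`. For a contact form it is a constant
multiple of `|a ∧ (da)ⁿ|`. -/
def density (a : E → E →L[ℝ] ℝ) (y : E) : ℝ := √|(gram b (contactBilin a y)).det|

/-- The derivative of `da + a ⊗ a` along a field `Y` with `a(Y) = 0` and `da(Y, ·) = f a - c`, where
`c` is closed. On the right, the first four terms are the Lie derivative, which is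
`d(f a - c) + (f a - c) ⊗ a + a ⊗ (f a - c)` by Cartan's formula; the last two terms account for the
derivative of `Y`. -/
lemma fderiv_contactBilin_eq {a c : E → E →L[ℝ] ℝ} {Y : E → E} {f : E → ℝ} {y : E}
    (ha : ContDiffAt ℝ 2 a y) (hc : DifferentiableAt ℝ c y) (hY : DifferentiableAt ℝ Y y)
    (hf : DifferentiableAt ℝ f y) (hdc : dForm c y = 0)
    (haY : ∀ᶠ z in nhds y, a z (Y z) = 0)
    (hdaY : ∀ᶠ z in nhds y, ∀ w, dForm a z (Y z) w = f z * a z w - c z w) (u w : E) :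
    fderiv ℝ (fderiv ℝ a) y (Y y) u w - fderiv ℝ (fderiv ℝ a) y (Y y) w u +
        (fderiv ℝ a y (Y y) u * a y w + a y u * fderiv ℝ a y (Y y) w) =
      f y * contactBilin a y u w + f y * (a y u * a y w) +
        (fderiv ℝ f y u * a y w - a y u * fderiv ℝ f y w) - (c y u * a y w + a y u * c y w) -
        contactBilin a y (fderiv ℝ Y y u) w - contactBilin a y u (fderiv ℝ Y y w) := by
  have ha1 : DifferentiableAt ℝ a y := ha.differentiableAt (by simp)
  have ha2 : DifferentiableAt ℝ (fderiv ℝ a) y :=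
    (ha.fderiv_right (m := 1) (by norm_num)).differentiableAt (by simp)
  have hsymm (u v : E) : fderiv ℝ (fderiv ℝ a) y u v = fderiv ℝ (fderiv ℝ a) y v u :=
    (ha.isSymmSndFDerivAt (by simp)) u v
  have e1 (u : E) : fderiv ℝ a y u (Y y) + a y (fderiv ℝ Y y u) = 0 := by
    have h1 := ha1.hasFDerivAt.clm_apply hY.hasFDerivAt
    have h2 : HasFDerivAt (fun z ↦ a z (Y z)) (0 : E →L[ℝ] ℝ) y :=
      (hasFDerivAt_const (0 : ℝ) y).congr_of_eventuallyEq haY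
    have := congrArg (fun D ↦ D u) (h1.unique h2)
    simpa [add_comm] using this
  have e2 (w : E) : fderiv ℝ a y (Y y) w - fderiv ℝ a y w (Y y) = f y * a y w - c y w :=
    hdaY.self_of_nhds w
  have e3 (u w : E) : fderiv ℝ (fderiv ℝ a) y u (Y y) w + fderiv ℝ a y (fderiv ℝ Y y u) w -
      (fderiv ℝ (fderiv ℝ a) y u w (Y y) + fderiv ℝ a y w (fderiv ℝ Y y u)) =
      fderiv ℝ f y u * a y w + f y * fderiv ℝ a y u w - fderiv ℝ c y u w := by
    have h1 := ((ha2.hasFDerivAt.clm_apply hY.hasFDerivAt).clm_apply (hasFDerivAt_const w y)).sub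
      ((ha2.hasFDerivAt.clm_apply (hasFDerivAt_const w y)).clm_apply hY.hasFDerivAt)
    have h2 := (hf.hasFDerivAt.mul (ha1.hasFDerivAt.clm_apply (hasFDerivAt_const w y))).sub
      (hc.hasFDerivAt.clm_apply (hasFDerivAt_const w y))
    have h3 := h2.congr_of_eventuallyEq (hdaY.mono fun z hz ↦ hz w)
    have := congrArg (fun D ↦ D u) (h1.unique h3)
    simp at this
    linarith
  have e4 : fderiv ℝ c y u w - fderiv ℝ c y w u = 0 := by
    rw [← dForm_apply, hdc]
    rfl
  simp only [contactBilin_apply, dForm_apply]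
  rw [hsymm (Y y) u, hsymm (Y y) w]
  have h5 := e3 u w
  have h6 := e3 w u
  rw [hsymm w u] at h6
  have h7 := e1 u
  have h8 := e1 w
  have h9 := e2 u
  have h10 := e2 w
  linear_combination h5 - h6 - e4 + a y w * h9 + a y u * h10 + a y w * h7 + a y u * h8

open Matrix in
/-- The divergence of `Y` with respect to the density of `a` is `n f`, in dimension `2n + 1`.

With `A` the matrix of `B = da + a ⊗ a`, the divergence is half the trace of `A⁻¹ L`, where `L` is the
matrix of the Lie derivative of `B`, that is, of `f B + f a ⊗ a + df ∧ a - c ⊗ a - a ⊗ c`. As the Reeb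
vector `r` represents `a` through `B` on either side, the trace of `A⁻¹ (p ⊗ q)` is the value at `r` of
`p` or `q` when the other one is `a`. The five terms thus contribute `(2n + 1) f`, `f`, `0`, `-f` and
`-f`. -/
theorem divergence_density {n : ℕ} (hι : Fintype.card ι = 2 * n + 1)
    {a c : E → E →L[ℝ] ℝ} {Y : E → E} {f : E → ℝ} {y r : E}
    (ha : ContDiffAt ℝ 2 a y) (hc : DifferentiableAt ℝ c y) (hY : DifferentiableAt ℝ Y y)
    (hf : DifferentiableAt ℝ f y) (hdc : dForm c y = 0)
    (haY : ∀ᶠ z in nhds y, a z (Y z) = 0)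
    (hdaY : ∀ᶠ z in nhds y, ∀ w, dForm a z (Y z) w = f z * a z w - c z w)
    (hB : Function.Injective (contactBilin a y))
    (har : a y r = 1) (hdr : ∀ w, dForm a y r w = 0) (hcr : c y r = f y) :
    ∃ D : E →L[ℝ] ℝ, HasFDerivAt (density b a) D y ∧
      D (Y y) + density b a y * LinearMap.trace ℝ E (fderiv ℝ Y y : E →ₗ[ℝ] E) =
        n * f y * density b a y := by
  have ha1 : DifferentiableAt ℝ a y := ha.differentiableAt (by simp)
  have ha2 : DifferentiableAt ℝ (fderiv ℝ a) y :=
    (ha.fderiv_right (m := 1) (by norm_num)).differentiableAt (by simp)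
  have hent (u w : E) : ∃ D : E →L[ℝ] ℝ, HasFDerivAt (fun z ↦ contactBilin a z u w) D y ∧
      ∀ v, D v = fderiv ℝ (fderiv ℝ a) y v u w - fderiv ℝ (fderiv ℝ a) y v w u +
        (fderiv ℝ a y v u * a y w + a y u * fderiv ℝ a y v w) := by
    have h (u w : E) := (ha2.hasFDerivAt.clm_apply (hasFDerivAt_const u y)).clm_apply
      (hasFDerivAt_const w y)
    have h' (u : E) := ha1.hasFDerivAt.clm_apply (hasFDerivAt_const u y)
    refine ⟨_, ((h u w).sub (h w u)).add ((h' u).mul (h' w)), fun v ↦ ?_⟩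
    simp
    ring
  choose A' hA' hA'v using hent
  obtain ⟨D, hD, hDv⟩ := hasFDerivAt_det (A := fun z ↦ gram b (contactBilin a z))
    (A' := fun i j ↦ A' (b i) (b j)) fun i j ↦ hA' (b i) (b j)
  set A := gram b (contactBilin a y) with hA
  have hdet : A.det ≠ 0 := det_gram_ne_zero b hB
  have hunit : IsUnit A.det := isUnit_iff_ne_zero.2 hdet
  set J := LinearMap.toMatrix b b (fderiv ℝ Y y : E →ₗ[ℝ] E) with hJ
  let va : ι → ℝ := fun i ↦ a y (b i)
  let vc : ι → ℝ := fun i ↦ c y (b i)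
  let vf : ι → ℝ := fun i ↦ fderiv ℝ f y (b i)
  let vr : ι → ℝ := fun i ↦ b.repr r i
  -- the matrix of the derivative of the form `da + a ⊗ a` in the direction of `Y`
  have hH : (Matrix.of fun i j ↦ A' (b i) (b j) (Y y)) =
      f y • A + f y • vecMulVec va va + (vecMulVec vf va - vecMulVec va vf) -
        (vecMulVec vc va + vecMulVec va vc) - J.transpose * A - A * J := by
    ext i j
    simp only [Matrix.sub_apply, Matrix.add_apply, Matrix.smul_apply, vecMulVec_apply, hJ, hA]
    rw [transpose_toMatrix_mul_gram, gram_mul_toMatrix, Matrix.of_apply, hA'v,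
      fderiv_contactBilin_eq ha hc hY hf hdc haY hdaY]
    rfl
  have hdot (p : E →L[ℝ] ℝ) : (fun i ↦ p (b i)) ⬝ᵥ vr = p r := by
    conv_rhs => rw [← b.sum_repr r, map_sum]
    simp [dotProduct, vr, mul_comm]
  have hskew (u w : E) : dForm a y u w = - dForm a y w u := by
    rw [dForm_apply, dForm_apply, neg_sub]
  -- the Reeb vector represents `a` on either side
  have hAr : A *ᵥ vr = va := by
    ext i
    have := hdot (contactBilin a y (b i))
    rw [contactBilin_apply, hskew, hdr, har, neg_zero, zero_add, mul_one] at this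
    exact this
  have hrA : vr ᵥ* A = va := by
    ext i
    have := hdot ((contactBilin a y).flip (b i))
    rw [ContinuousLinearMap.flip_apply, contactBilin_apply, hdr, har, zero_add, one_mul,
      dotProduct_comm] at this
    exact this
  have hAr' : A⁻¹ *ᵥ va = vr := by
    rw [← hAr, Matrix.mulVec_mulVec, Matrix.nonsing_inv_mul _ hunit, Matrix.one_mulVec]
  have hrA' : va ᵥ* A⁻¹ = vr := by
    rw [← hrA, Matrix.vecMul_vecMul, Matrix.mul_nonsing_inv _ hunit, Matrix.vecMul_one]
  have hval (p : E →L[ℝ] ℝ) : va ⬝ᵥ (A⁻¹ *ᵥ fun i ↦ p (b i)) = p r := by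
    rw [Matrix.dotProduct_mulVec, hrA', dotProduct_comm, hdot]
  have htr : (A⁻¹ * Matrix.of fun i j ↦ A' (b i) (b j) (Y y)).trace =
      2 * (n * f y) - 2 * J.trace := by
    rw [hH]
    simp only [Matrix.mul_sub, Matrix.mul_add, Matrix.mul_smul, Matrix.trace_sub,
      Matrix.trace_add, Matrix.trace_smul, trace_inv_mul_vecMulVec, hAr',
      Matrix.nonsing_inv_mul _ hunit, Matrix.trace_one, hι]
    rw [← Matrix.mul_assoc A⁻¹ A J, Matrix.nonsing_inv_mul _ hunit, Matrix.one_mul,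
      Matrix.trace_mul_comm A⁻¹, Matrix.mul_assoc, Matrix.mul_nonsing_inv _ hunit,
      Matrix.mul_one, Matrix.trace_transpose]
    rw [show va ⬝ᵥ vr = a y r from hdot _, show vf ⬝ᵥ vr = _ from hdot _,
      show vc ⬝ᵥ vr = _ from hdot _, show va ⬝ᵥ (A⁻¹ *ᵥ vf) = _ from hval _,
      show va ⬝ᵥ (A⁻¹ *ᵥ vc) = _ from hval _, har, hcr]
    simp only [smul_eq_mul]
    push_cast
    ring
  have hDY : D (Y y) = A.det * (2 * (n * f y) - 2 * J.trace) := by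
    rw [hDv, ← htr, Matrix.inv_def, Matrix.smul_mul, Matrix.trace_smul, Ring.inverse_eq_inv',
      smul_eq_mul, mul_inv_cancel_left₀ hdet]
  have hw : HasFDerivAt (density b a) _ y := (hD.abs hdet).sqrt (abs_ne_zero.2 hdet)
  refine ⟨_, hw, ?_⟩
  have hsq : density b a y * density b a y = |A.det| := Real.mul_self_sqrt (abs_nonneg _)
  have hpos : density b a y ≠ 0 := fun h ↦ hdet (abs_eq_zero.1 (by rw [← hsq, h, mul_zero]))
  have htrace : LinearMap.trace ℝ E (fderiv ℝ Y y : E →ₗ[ℝ] E) = J.trace :=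
    LinearMap.trace_eq_matrix_trace ℝ b _
  change ((1 / (2 * density b a y)) • (SignType.sign A.det : ℝ) • D) (Y y) + _ = _
  rw [htrace, _root_.smul_apply, _root_.smul_apply, hDY, smul_eq_mul,
    smul_eq_mul, ← mul_assoc (SignType.sign A.det : ℝ), sign_mul_self, ← hsq]
  field_simp
  ring

end Divergence

/-! ### The divergence theorem on a vector space -/

section DivergenceTheorem

open MeasureTheory

variable {E : Type*} [NormedAddCommGroup E] [NormedSpace ℝ E] [FiniteDimensional ℝ E]
  [MeasurableSpace E] [BorelSpace E] (μ : Measure E) [μ.IsAddHaarMeasure]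

lemma integral_fderiv_apply_eq_zero {g : E → ℝ} (hg : ContDiff ℝ 1 g) (hc : HasCompactSupport g)
    (v : E) : ∫ y, fderiv ℝ g y v ∂μ = 0 := by
  have hg' : Continuous fun y ↦ fderiv ℝ g y v :=
    (hg.continuous_fderiv (by simp)).clm_apply continuous_const
  have hc' : HasCompactSupport fun y ↦ fderiv ℝ g y v := hc.fderiv_apply ℝ v
  have h := integral_mul_fderiv_eq_neg_fderiv_mul_of_integrable (μ := μ) (f := fun _ : E ↦ (1 : ℝ))
    (g := g) (v := v) (by simp) (by simpa using hg'.integrable_of_hasCompactSupport hc')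
    (by simpa using hg.continuous.integrable_of_hasCompactSupport hc)
    (fun _ _ ↦ differentiableAt_const _) (fun _ _ ↦ hg.differentiable (by simp) _)
  simpa using h

/-- The divergence theorem for a compactly supported vector field. -/
theorem integral_trace_fderiv_eq_zero {W : E → E} (hW : ContDiff ℝ 1 W)
    (hc : HasCompactSupport W) :
    ∫ y, LinearMap.trace ℝ E (fderiv ℝ W y : E →ₗ[ℝ] E) ∂μ = 0 := by
  let b := Module.finBasis ℝ E
  let p (i) : E →L[ℝ] ℝ := (b.coord i).toContinuousLinearMap
  have hp (i) : ContDiff ℝ 1 fun y ↦ p i (W y) := (p i).contDiff.comp hW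
  have hpc (i) : HasCompactSupport fun y ↦ p i (W y) := hc.comp_left (map_zero (p i))
  have htr (y : E) : LinearMap.trace ℝ E (fderiv ℝ W y : E →ₗ[ℝ] E) =
      ∑ i, fderiv ℝ (fun y ↦ p i (W y)) y (b i) := by
    rw [LinearMap.trace_eq_matrix_trace ℝ b, Matrix.trace]
    refine Finset.sum_congr rfl fun i _ ↦ ?_
    have h : HasFDerivAt (fun y ↦ p i (W y)) ((p i).comp (fderiv ℝ W y)) y :=
      (p i).hasFDerivAt.comp y (hW.differentiable (by simp) y).hasFDerivAt
    rw [h.fderiv, Matrix.diag, LinearMap.toMatrix_apply]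
    rfl
  simp only [htr]
  rw [integral_finsetSum]
  · exact Finset.sum_eq_zero fun i _ ↦ integral_fderiv_apply_eq_zero μ (hp i) (hpc i) _
  · intro i _
    exact (((hp i).continuous_fderiv (by simp)).clm_apply
      continuous_const).integrable_of_hasCompactSupport ((hpc i).fderiv_apply ℝ _)

end DivergenceTheorem

/-! ### Integration of functions over chart domains -/

section ChartIntegral

open Set Topology MeasureTheory _root_.Filter

section Density

variable {E : Type*} [NormedAddCommGroup E] [NormedSpace ℝ E] [FiniteDimensional ℝ E]
  {ι : Type*} [Fintype ι] [DecidableEq ι] (b : Module.Basis ι ℝ E)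

lemma contDiffOn_density {a : E → E →L[ℝ] ℝ} {U : Set E} (hU : IsOpen U) (ha : ContDiffOn ℝ ∞ a U)
    (hB : ∀ y ∈ U, Function.Injective (contactBilin a y)) :
    ContDiffOn ℝ ∞ (density b a) U := by
  have hdet : ContDiffOn ℝ ∞ (fun y ↦ (gram b (contactBilin a y)).det) U := by
    simp only [Matrix.det_apply, gram_apply]
    refine ContDiffOn.sum fun σ _ ↦ ContDiffOn.const_smul _ (contDiffOn_prod fun i _ ↦ ?_)
    exact ((contDiffOn_contactBilin hU ha).clm_apply contDiffOn_const).clm_apply contDiffOn_const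
  intro y hy
  have h0 := det_gram_ne_zero b (hB y hy)
  have h1 := (hdet.contDiffAt (hU.mem_nhds hy)).abs h0
  exact (h1.sqrt (abs_ne_zero.2 h0)).contDiffWithinAt

omit [FiniteDimensional ℝ E] in
lemma density_pos {a : E → E →L[ℝ] ℝ} {y : E} (hB : Function.Injective (contactBilin a y)) :
    0 < density b a y :=
  Real.sqrt_pos.2 (abs_pos.2 (det_gram_ne_zero b hB))

omit [FiniteDimensional ℝ E] in
lemma density_of_comp {a a' : E → E →L[ℝ] ℝ} {y y' : E} {T : E →L[ℝ] E}
    (h : ∀ u w, contactBilin a y u w = contactBilin a' y' (T u) (T w)) :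
    density b a y = |T.det| * density b a' y' := by
  rw [density, density, det_gram_of_comp b h, abs_mul, abs_pow, Real.sqrt_mul (by positivity),
    Real.sqrt_sq (abs_nonneg _)]

end Density

variable {d : ℕ} {M : Type*} [TopologicalSpace M] [ChartedSpace (EuclideanSpace ℝ (Fin d)) M]
  [IsManifold (𝓡 d) ∞ M]

local notation "𝔼" => EuclideanSpace ℝ (Fin d)

/-- The density of the form `α` in the chart centred at `c`. -/
def chartDensity (α : OneForm d M) (c : M) : 𝔼 → ℝ :=
  density (EuclideanSpace.basisFun (Fin d) ℝ).toBasis (chartForm α c)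

/-- The integral of `h` over the domain of the chart centred at `c`, with respect to the density
of `α`. -/
def chartIntegral (α : OneForm d M) (c : M) (h : M → ℝ) : ℝ :=
  ∫ y in (extChartAt (𝓡 d) c).target, chartDensity α c y * h ((extChartAt (𝓡 d) c).symm y)

lemma contDiffOn_chartDensity {α : OneForm d M} (hα : HasTrivialKernel ⇑α) (c : M) :
    ContDiffOn ℝ ∞ (chartDensity α c) (extChartAt (𝓡 d) c).target :=
  contDiffOn_density _ (isOpen_extChartAt_target c) (contDiffOn_chartForm α c)
    fun _ hy ↦ contactBilin_chartForm_injective hα hy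

lemma chartDensity_pos {α : OneForm d M} (hα : HasTrivialKernel ⇑α) {c : M} {y : 𝔼}
    (hy : y ∈ (extChartAt (𝓡 d) c).target) : 0 < chartDensity α c y :=
  density_pos _ (contactBilin_chartForm_injective hα hy)

/-- Change of variables: the integral of a function supported in two chart domains does not depend
on the chart. -/
theorem chartIntegral_eq_of_support (α : OneForm d M) {c c' : M} {h : M → ℝ}
    (hc : ∀ x, h x ≠ 0 → x ∈ (extChartAt (𝓡 d) c).source)
    (hc' : ∀ x, h x ≠ 0 → x ∈ (extChartAt (𝓡 d) c').source) :
    chartIntegral α c h = chartIntegral α c' h := by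
  let O (c c' : M) : Set 𝔼 :=
    (extChartAt (𝓡 d) c).target ∩ (extChartAt (𝓡 d) c).symm ⁻¹' (extChartAt (𝓡 d) c').source
  have hO (c c' : M) : IsOpen (O c c') :=
    (continuousOn_extChartAt_symm c).isOpen_inter_preimage (isOpen_extChartAt_target c)
      (isOpen_extChartAt_source c')
  have hres (c c' : M) (hc' : ∀ x, h x ≠ 0 → x ∈ (extChartAt (𝓡 d) c').source) :
      chartIntegral α c h =
        ∫ y in O c c', chartDensity α c y * h ((extChartAt (𝓡 d) c).symm y) := by
    refine setIntegral_eq_of_subset_of_forall_sdiff_eq_zero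
      (isOpen_extChartAt_target c).measurableSet inter_subset_left fun y hy ↦ ?_
    by_contra h0
    exact hy.2 ⟨hy.1, hc' _ (right_ne_zero_of_mul h0)⟩
  rw [hres c c' hc', hres c' c hc]
  let τ : 𝔼 → 𝔼 := fun y ↦ extChartAt (𝓡 d) c' ((extChartAt (𝓡 d) c).symm y)
  let T (y : 𝔼) : 𝔼 →L[ℝ] 𝔼 :=
    (dChart c' ((extChartAt (𝓡 d) c).symm y)).comp (dChartSymm c y)
  have hτ : ∀ y ∈ O c c', HasFDerivAt τ (T y) y := fun y hy ↦
    hasMFDerivAt_iff_hasFDerivAt.1 ((mdifferentiableAt_chart hy.2).hasMFDerivAt.comp y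
      (mdifferentiableAt_chartSymm hy.1).hasMFDerivAt)
  have hinj : InjOn τ (O c c') := fun y hy z hz hyz ↦
    (extChartAt (𝓡 d) c).symm.injOn hy.1 hz.1 ((extChartAt (𝓡 d) c').injOn hy.2 hz.2 hyz)
  have himage : τ '' O c c' = O c' c := by
    ext z
    constructor
    · rintro ⟨y, hy, rfl⟩
      refine ⟨(extChartAt (𝓡 d) c').map_source hy.2, ?_⟩
      rw [mem_preimage, (extChartAt (𝓡 d) c').left_inv hy.2]
      exact (extChartAt (𝓡 d) c).map_target hy.1
    · intro hz
      have h1 := (extChartAt (𝓡 d) c).left_inv hz.2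
      refine ⟨extChartAt (𝓡 d) c ((extChartAt (𝓡 d) c').symm z),
        ⟨(extChartAt (𝓡 d) c).map_source hz.2, ?_⟩, ?_⟩
      · rw [mem_preimage, h1]
        exact (extChartAt (𝓡 d) c').map_target hz.1
      · change extChartAt (𝓡 d) c' _ = z
        rw [h1, (extChartAt (𝓡 d) c').right_inv hz.1]
  rw [← himage, integral_image_eq_integral_abs_det_fderiv_smul volume (hO c c').measurableSet
    (fun y hy ↦ (hτ y hy).hasFDerivWithinAt) hinj]
  refine setIntegral_congr_fun (hO c c').measurableSet fun y hy ↦ ?_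
  have hdens : chartDensity α c y = |(T y).det| * chartDensity α c' (τ y) := by
    refine density_of_comp _ fun u w ↦ ?_
    have hx := (extChartAt (𝓡 d) c).map_target hy.1
    have h1 := contactBilin_chartForm α hx (dChartSymm c y u) (dChartSymm c y w)
    rw [dChart_dChartSymm hy.1, dChart_dChartSymm hy.1,
      (extChartAt (𝓡 d) c).right_inv hy.1] at h1
    rw [h1, ← contactBilin_chartForm α hy.2]
    rfl
  have hpt : (extChartAt (𝓡 d) c').symm (τ y) = (extChartAt (𝓡 d) c).symm y :=
    (extChartAt (𝓡 d) c').left_inv hy.2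
  simp only [hdens, hpt, smul_eq_mul, mul_assoc]

section Extension

variable {E : Type*} [NormedAddCommGroup E] [NormedSpace ℝ E]
  {F : Type*} [NormedAddCommGroup F] [NormedSpace ℝ F]

/-- A function on an open set `U` that vanishes off a compact subset of `U` extends by zero. -/
lemma contDiff_indicator {U K : Set E} {n : ℕ∞ω} {φ : E → F} (hU : IsOpen U) (hK : IsCompact K)
    (hKU : K ⊆ U) (hφ : ContDiffOn ℝ n φ U) (h0 : ∀ y ∈ U, y ∉ K → φ y = 0) :
    ContDiff ℝ n (U.indicator φ) ∧ HasCompactSupport (U.indicator φ) ∧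
      tsupport (U.indicator φ) ⊆ K := by
  have hz : ∀ y ∉ K, U.indicator φ y = 0 := fun y hy ↦ by
    by_cases hyU : y ∈ U
    · rw [indicator_of_mem hyU, h0 y hyU hy]
    · exact indicator_of_notMem hyU _
  refine ⟨contDiff_iff_contDiffAt.2 fun y ↦ ?_, HasCompactSupport.intro hK hz,
    closure_minimal (fun y hy ↦ not_imp_comm.1 (hz y) hy) hK.isClosed⟩
  by_cases hyU : y ∈ U
  · refine (hφ.contDiffAt (hU.mem_nhds hyU)).congr_of_eventuallyEq ?_
    filter_upwards [hU.mem_nhds hyU] with z hz using indicator_of_mem hz _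
  · refine (contDiffAt_const (c := (0 : F))).congr_of_eventuallyEq ?_
    filter_upwards [hK.isClosed.isOpen_compl.mem_nhds fun h ↦ hyU (hKU h)] with z hz'
    exact hz z hz'

end Extension

end ChartIntegral

/-! ### The divergence theorem on chart domains -/

section LieDivergence

open Set Topology MeasureTheory _root_.Filter

variable {d : ℕ} {M : Type*} [TopologicalSpace M] [ChartedSpace (EuclideanSpace ℝ (Fin d)) M]

local notation "𝔼" => EuclideanSpace ℝ (Fin d)

/-- The derivative of the function `g` along the vector field `Y`. -/
def lieDeriv (Y : (x : M) → TangentSpace (𝓡 d) x) (g : M → ℝ) (x : M) : ℝ :=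
  mfderiv (𝓡 d) 𝓘(ℝ, ℝ) g x (Y x)

variable [IsManifold (𝓡 d) ∞ M]

lemma contDiffOn_comp_chartSymm {g : M → ℝ} (hg : ContMDiff (𝓡 d) 𝓘(ℝ, ℝ) ∞ g) (c : M) :
    ContDiffOn ℝ ∞ (g ∘ (extChartAt (𝓡 d) c).symm) (extChartAt (𝓡 d) c).target :=
  (contDiffOn_chart_iff c).1 hg.contMDiffOn

lemma fderiv_comp_chartSymm {g : M → ℝ} (hg : ContMDiff (𝓡 d) 𝓘(ℝ, ℝ) ∞ g)
    (Y : (x : M) → TangentSpace (𝓡 d) x) {c : M} {y : 𝔼} (hy : y ∈ (extChartAt (𝓡 d) c).target) :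
    fderiv ℝ (g ∘ (extChartAt (𝓡 d) c).symm) y (chartVec Y c y) =
      lieDeriv Y g ((extChartAt (𝓡 d) c).symm y) := by
  have h1 := (hg.mdifferentiableAt (x := (extChartAt (𝓡 d) c).symm y) (by simp)).hasMFDerivAt
  let A : 𝔼 →L[ℝ] ℝ := (mfderiv (𝓡 d) 𝓘(ℝ, ℝ) g ((extChartAt (𝓡 d) c).symm y)).comp
    (dChartSymm c y)
  have h2 : HasMFDerivAt 𝓘(ℝ, 𝔼) 𝓘(ℝ, ℝ) (g ∘ (extChartAt (𝓡 d) c).symm) y A :=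
    h1.comp y (mdifferentiableAt_chartSymm hy).hasMFDerivAt
  have h3 : HasFDerivAt (g ∘ (extChartAt (𝓡 d) c).symm) A y := hasMFDerivAt_iff_hasFDerivAt.1 h2
  rw [h3.fderiv, lieDeriv, ← dChartSymm_chartVec Y hy]
  rfl

lemma continuous_lieDeriv {g : M → ℝ} (hg : ContMDiff (𝓡 d) 𝓘(ℝ, ℝ) ∞ g)
    {Y : (x : M) → TangentSpace (𝓡 d) x}
    (hY : ContMDiff (𝓡 d) (𝓡 d).tangent ∞ (fun x ↦ (⟨x, Y x⟩ : TangentBundle (𝓡 d) M))) :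
    Continuous (lieDeriv Y g) := by
  refine continuous_iff_continuousAt.2 fun c ↦ ?_
  have hT := isOpen_extChartAt_target (I := 𝓡 d) c
  have h1 : ContDiffOn ℝ ∞ (lieDeriv Y g ∘ (extChartAt (𝓡 d) c).symm)
      (extChartAt (𝓡 d) c).target := by
    refine ContDiffOn.congr ?_ fun y hy ↦ (fderiv_comp_chartSymm hg Y hy).symm
    exact ((contDiffOn_comp_chartSymm hg c).fderiv_of_isOpen hT (by simp)).clm_apply
      (contDiffOn_chartVec hY c)
  exact (((contDiffOn_chart_iff c).2 h1).contMDiffAt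
    ((chartAt 𝔼 c).open_source.mem_nhds (mem_chart_source _ c))).continuousAt

lemma continuous_chartIntegrand [CompactSpace M] {α : OneForm d M} (hα : HasTrivialKernel ⇑α)
    {c : M} {h : M → ℝ} (hh : Continuous h) (hc : tsupport h ⊆ (extChartAt (𝓡 d) c).source) :
    Continuous ((extChartAt (𝓡 d) c).target.indicator
      fun y ↦ chartDensity α c y * h ((extChartAt (𝓡 d) c).symm y)) ∧
    HasCompactSupport ((extChartAt (𝓡 d) c).target.indicator
      fun y ↦ chartDensity α c y * h ((extChartAt (𝓡 d) c).symm y)) := by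
  have h1 : ContDiffOn ℝ 0 (fun y ↦ chartDensity α c y * h ((extChartAt (𝓡 d) c).symm y))
      (extChartAt (𝓡 d) c).target :=
    contDiffOn_zero.2 ((contDiffOn_chartDensity hα c).continuousOn.mul
      (hh.comp_continuousOn (continuousOn_extChartAt_symm c)))
  obtain ⟨h2, h3, -⟩ := contDiff_indicator (isOpen_extChartAt_target (I := 𝓡 d) c)
    ((isClosed_tsupport h).isCompact.image_of_continuousOn ((continuousOn_extChartAt c).mono hc))
    (by rintro _ ⟨x, hx, rfl⟩; exact (extChartAt (𝓡 d) c).map_source (hc hx)) h1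
    fun y hy hyK ↦ by
      have : h ((extChartAt (𝓡 d) c).symm y) = 0 := image_eq_zero_of_notMem_tsupport
        fun hx ↦ hyK ⟨_, hx, (extChartAt (𝓡 d) c).right_inv hy⟩
      rw [this, mul_zero]
  exact ⟨h2.continuous, h3⟩

lemma chartIntegral_sum [CompactSpace M] {α : OneForm d M} (hα : HasTrivialKernel ⇑α) {c : M}
    {ι : Type*} {s : Finset ι} {u : ι → M → ℝ} (hu : ∀ i ∈ s, Continuous (u i))
    (hc : ∀ i ∈ s, tsupport (u i) ⊆ (extChartAt (𝓡 d) c).source) :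
    chartIntegral α c (fun x ↦ ∑ i ∈ s, u i x) = ∑ i ∈ s, chartIntegral α c (u i) := by
  simp only [chartIntegral, Finset.mul_sum]
  refine integral_finsetSum _ fun i hi ↦ ?_
  obtain ⟨h1, h2⟩ := continuous_chartIntegrand hα (hu i hi) (hc i hi)
  exact (integrable_indicator_iff (isOpen_extChartAt_target (I := 𝓡 d) c).measurableSet).1
    (h1.integrable_of_hasCompactSupport h2)

lemma chartDensity_nonneg (α : OneForm d M) (c : M) (y : 𝔼) :
    0 ≤ chartDensity α c y :=
  Real.sqrt_nonneg _

lemma chartIntegral_nonneg (α : OneForm d M) {c : M} {h : M → ℝ} (hh : ∀ x, 0 ≤ h x) :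
    0 ≤ chartIntegral α c h :=
  integral_nonneg fun _ ↦ mul_nonneg (chartDensity_nonneg α c _) (hh _)

lemma eq_zero_of_chartIntegral_eq_zero [CompactSpace M] {α : OneForm d M}
    (hα : HasTrivialKernel ⇑α) {c : M} {h : M → ℝ} (hh : Continuous h)
    (hc : tsupport h ⊆ (extChartAt (𝓡 d) c).source) (h0 : ∀ x, 0 ≤ h x)
    (hint : chartIntegral α c h = 0) {x : M} (hx : x ∈ (extChartAt (𝓡 d) c).source) :
    h x = 0 := by
  obtain ⟨h1, h2⟩ := continuous_chartIntegrand hα hh hc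
  have hT := isOpen_extChartAt_target (I := 𝓡 d) c
  rw [chartIntegral, ← integral_indicator hT.measurableSet,
    integral_eq_zero_iff_of_nonneg
      (indicator_nonneg fun y _ ↦ mul_nonneg (chartDensity_nonneg α c _) (h0 _))
      (h1.integrable_of_hasCompactSupport h2),
    Continuous.ae_eq_iff_eq volume h1 continuous_zero] at hint
  have hy := (extChartAt (𝓡 d) c).map_source hx
  have := congrFun hint (extChartAt (𝓡 d) c x)
  rw [indicator_of_mem hy, (extChartAt (𝓡 d) c).left_inv hx] at this
  exact (mul_eq_zero.1 this).resolve_left (chartDensity_pos hα hy).ne'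

variable {n : ℕ} {α γ : OneForm d M} {R Y : (x : M) → TangentSpace (𝓡 d) x}

/-- The divergence identity of `divergence_density`, in a chart of a manifold. -/
lemma divergence_chartDensity (hd : d = 2 * n + 1) (hα : HasTrivialKernel ⇑α)
    (hγ : IsClosedForm ⇑γ) (hR : IsReebField (⇑α) R)
    (hY : ContMDiff (𝓡 d) (𝓡 d).tangent ∞ (fun x ↦ (⟨x, Y x⟩ : TangentBundle (𝓡 d) M)))
    (hαY : ∀ x, α x (Y x) = 0)
    (hdαY : ∀ x v, extD α x ![Y x, v] = γ x (R x) * α x v - γ x v)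
    {c : M} {y : 𝔼} (hy : y ∈ (extChartAt (𝓡 d) c).target) :
    ∃ D : 𝔼 →L[ℝ] ℝ, HasFDerivAt (chartDensity α c) D y ∧
      D (chartVec Y c y) +
        chartDensity α c y * LinearMap.trace ℝ 𝔼 (fderiv ℝ (chartVec Y c) y : 𝔼 →ₗ[ℝ] 𝔼) =
      n * γ ((extChartAt (𝓡 d) c).symm y) (R ((extChartAt (𝓡 d) c).symm y)) *
        chartDensity α c y := by
  have hT := isOpen_extChartAt_target (I := 𝓡 d) c
  have hmem := hT.mem_nhds hy
  have hform (β : OneForm d M) : ContDiffAt ℝ ∞ (chartForm β c) y :=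
    (contDiffOn_chartForm β c).contDiffAt hmem
  have hvec {X : (x : M) → TangentSpace (𝓡 d) x}
      (hX : ContMDiff (𝓡 d) (𝓡 d).tangent ∞ (fun x ↦ (⟨x, X x⟩ : TangentBundle (𝓡 d) M))) :
      ContDiffAt ℝ ∞ (chartVec X c) y := (contDiffOn_chartVec hX c).contDiffAt hmem
  have hext (β : OneForm d M) {z : 𝔼} (hz : z ∈ (extChartAt (𝓡 d) c).target) (u w : 𝔼) :
      dForm (chartForm β c) z u w =
        extD β ((extChartAt (𝓡 d) c).symm z) ![dChartSymm c z u, dChartSymm c z w] := by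
    rw [extD_eq_dForm β ((extChartAt (𝓡 d) c).map_target hz),
      (extChartAt (𝓡 d) c).right_inv hz, dChart_dChartSymm hz, dChart_dChartSymm hz]
  have key := divergence_density (EuclideanSpace.basisFun (Fin d) ℝ).toBasis (n := n)
    (a := chartForm α c) (c := chartForm γ c) (Y := chartVec Y c)
    (f := fun z ↦ chartForm γ c z (chartVec R c z)) (y := y) (r := chartVec R c y)
    (by rw [Fintype.card_fin, hd])
    ((hform α).of_le (WithTop.coe_le_coe.2 (le_top : (2 : ℕ∞) ≤ ⊤)))
    ((hform γ).differentiableAt (by simp)) ((hvec hY).differentiableAt (by simp))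
    (((hform γ).clm_apply (hvec hR.smooth)).differentiableAt (by simp))
    (by
      ext u w
      rw [hext γ hy, hγ]
      rfl)
    (by
      filter_upwards [hmem] with z hz
      rw [chartForm_chartVec _ _ hz, hαY])
    (by
      filter_upwards [hmem] with z hz w
      rw [hext α hz, dChartSymm_chartVec Y hz, hdαY, chartForm_chartVec _ _ hz]
      rfl)
    (contactBilin_chartForm_injective hα hy)
    (by rw [chartForm_chartVec _ _ hy, hR.apply_eq_one])
    (fun w ↦ by rw [hext α hy, dChartSymm_chartVec R hy, hR.extD_eq_zero])
    rfl
  obtain ⟨D, hD, h⟩ := key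
  refine ⟨D, hD, h.trans ?_⟩
  rw [← chartForm_chartVec _ _ hy]
  rfl

/-- The divergence theorem on a chart domain, for the field `g Y`. -/
theorem chartIntegral_divergence [CompactSpace M] (hd : d = 2 * n + 1) (hα : HasTrivialKernel ⇑α)
    (hγ : IsClosedForm ⇑γ) (hR : IsReebField (⇑α) R)
    (hY : ContMDiff (𝓡 d) (𝓡 d).tangent ∞ (fun x ↦ (⟨x, Y x⟩ : TangentBundle (𝓡 d) M)))
    (hαY : ∀ x, α x (Y x) = 0)
    (hdαY : ∀ x v, extD α x ![Y x, v] = γ x (R x) * α x v - γ x v)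
    {c : M} {g : M → ℝ} (hg : ContMDiff (𝓡 d) 𝓘(ℝ, ℝ) ∞ g)
    (hc : tsupport g ⊆ (extChartAt (𝓡 d) c).source) :
    chartIntegral α c (fun x ↦ g x * (n * γ x (R x)) + lieDeriv Y g x) = 0 := by
  have hT := isOpen_extChartAt_target (I := 𝓡 d) c
  let φ : 𝔼 → ℝ := fun y ↦ (g ∘ (extChartAt (𝓡 d) c).symm) y * chartDensity α c y
  let W : 𝔼 → 𝔼 := fun y ↦ φ y • chartVec Y c y
  have hφ : ContDiffOn ℝ ∞ φ (extChartAt (𝓡 d) c).target :=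
    (contDiffOn_comp_chartSymm hg c).mul (contDiffOn_chartDensity hα c)
  have hW : ContDiffOn ℝ 1 W (extChartAt (𝓡 d) c).target :=
    (hφ.smul (contDiffOn_chartVec hY c)).of_le (WithTop.coe_le_coe.2 (le_top : (1 : ℕ∞) ≤ ⊤))
  obtain ⟨h1, h2, h4⟩ := contDiff_indicator hT
    ((isClosed_tsupport g).isCompact.image_of_continuousOn ((continuousOn_extChartAt c).mono hc))
    (by rintro _ ⟨x, hx, rfl⟩; exact (extChartAt (𝓡 d) c).map_source (hc hx)) hW
    fun y hy hyK ↦ by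
      have : g ((extChartAt (𝓡 d) c).symm y) = 0 := image_eq_zero_of_notMem_tsupport
        fun hx ↦ hyK ⟨_, hx, (extChartAt (𝓡 d) c).right_inv hy⟩
      simp only [W, φ, Function.comp_apply, this, zero_mul, zero_smul]
  have h3 := integral_trace_fderiv_eq_zero volume h1 h2
  rw [← h3, chartIntegral, ← integral_indicator hT.measurableSet]
  refine integral_congr_ae (Eventually.of_forall fun y ↦ ?_)
  by_cases hy : y ∈ (extChartAt (𝓡 d) c).target
  · have hev : (extChartAt (𝓡 d) c).target.indicator W =ᶠ[𝓝 y] W := by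
      filter_upwards [hT.mem_nhds hy] with z hz using indicator_of_mem hz _
    obtain ⟨D, hD, hdiv⟩ := divergence_chartDensity hd hα hγ hR hY hαY hdαY hy
    have hg' : DifferentiableAt ℝ (g ∘ (extChartAt (𝓡 d) c).symm) y :=
      ((contDiffOn_comp_chartSymm hg c).contDiffAt (hT.mem_nhds hy)).differentiableAt (by simp)
    have hY' : DifferentiableAt ℝ (chartVec Y c) y :=
      ((contDiffOn_chartVec hY c).contDiffAt (hT.mem_nhds hy)).differentiableAt (by simp)
    have hfW := ((hg'.hasFDerivAt.mul hD).smul hY'.hasFDerivAt).fderiv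
    change (extChartAt (𝓡 d) c).target.indicator _ y = LinearMap.trace ℝ 𝔼
      (fderiv ℝ ((extChartAt (𝓡 d) c).target.indicator W) y : 𝔼 →ₗ[ℝ] 𝔼)
    rw [indicator_of_mem hy, hev.fderiv_eq]
    have hfW' : fderiv ℝ W y = _ := hfW
    rw [hfW', ContinuousLinearMap.toLinearMap_add, map_add, ContinuousLinearMap.toLinearMap_smul, map_smul]
    have htr (p : 𝔼 →L[ℝ] ℝ) (v : 𝔼) :
        LinearMap.trace ℝ 𝔼 (p.smulRight v : 𝔼 →ₗ[ℝ] 𝔼) = p v :=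
      LinearMap.trace_smulRight _ _
    rw [htr, add_apply, smul_apply,
      smul_apply, fderiv_comp_chartSymm hg Y hy]
    simp only [Pi.mul_apply, Function.comp_apply, smul_eq_mul]
    linear_combination (-g ((extChartAt (𝓡 d) c).symm y)) * hdiv
  · have hz : y ∉ tsupport ((extChartAt (𝓡 d) c).target.indicator W) := fun h ↦ by
      obtain ⟨x, hx, rfl⟩ := h4 h
      exact hy ((extChartAt (𝓡 d) c).map_source (hc hx))
    change (extChartAt (𝓡 d) c).target.indicator _ y = LinearMap.trace ℝ 𝔼
      (fderiv ℝ ((extChartAt (𝓡 d) c).target.indicator W) y : 𝔼 →ₗ[ℝ] 𝔼)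
    rw [indicator_of_notMem hy, fderiv_of_notMem_tsupport ℝ hz, ContinuousLinearMap.toLinearMap_zero,
      map_zero]

end LieDivergence

/-! ### Functions that are divergences on a closed manifold -/

section Stokes

open Set Topology _root_.Filter

variable {d n : ℕ} {M : Type*} [TopologicalSpace M] [ChartedSpace (EuclideanSpace ℝ (Fin d)) M]
  [IsManifold (𝓡 d) ∞ M]

local notation "𝔼" => EuclideanSpace ℝ (Fin d)

variable {α γ : OneForm d M} {R Y : (x : M) → TangentSpace (𝓡 d) x}

lemma contMDiff_oneForm_apply (γ : OneForm d M)
    (hR : ContMDiff (𝓡 d) (𝓡 d).tangent ∞ (fun x ↦ (⟨x, R x⟩ : TangentBundle (𝓡 d) M))) :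
    ContMDiff (𝓡 d) 𝓘(ℝ, ℝ) ∞ fun x ↦ γ x (R x) := by
  intro c
  have h1 : ContDiffOn ℝ ∞ ((fun x ↦ γ x (R x)) ∘ (extChartAt (𝓡 d) c).symm)
      (extChartAt (𝓡 d) c).target :=
    ((contDiffOn_chartForm γ c).clm_apply (contDiffOn_chartVec hR c)).congr
      fun y hy ↦ (chartForm_chartVec _ _ hy).symm
  exact ((contDiffOn_chart_iff c).2 h1).contMDiffAt
    ((chartAt 𝔼 c).open_source.mem_nhds (mem_chart_source _ c))

lemma lieDeriv_sum_eq_zero (Y : (x : M) → TangentSpace (𝓡 d) x) {ι : Type*} {s : Finset ι}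
    {g : ι → M → ℝ} (hg : ∀ i, ContMDiff (𝓡 d) 𝓘(ℝ, ℝ) ∞ (g i)) (h1 : ∀ x, ∑ i ∈ s, g i x = 1)
    (x : M) : ∑ i ∈ s, lieDeriv Y (g i) x = 0 := by
  have hy := mem_extChartAt_target (I := 𝓡 d) x
  have h (i : ι) := fderiv_comp_chartSymm (hg i) Y hy
  rw [extChartAt_to_inv] at h
  simp only [← h]
  rw [← sum_apply, ← fderiv_fun_sum]
  · simp [h1]
  · intro i _
    exact ((contDiffOn_comp_chartSymm (hg i) x).contDiffAt
      (chart_target_mem_nhds hy)).differentiableAt (by simp)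

/-- The function `γ(R)`, being a constant multiple of the divergence of a vector field on a closed
manifold, vanishes identically as soon as it is nonnegative. This uses `n ≥ 1`. -/
theorem apply_reeb_eq_zero_of_nonneg [T2Space M] [CompactSpace M] (hn : 1 ≤ n)
    (hd : d = 2 * n + 1) (hα : HasTrivialKernel ⇑α)
    (hγ : IsClosedForm ⇑γ) (hR : IsReebField (⇑α) R)
    (hY : ContMDiff (𝓡 d) (𝓡 d).tangent ∞ (fun x ↦ (⟨x, Y x⟩ : TangentBundle (𝓡 d) M)))
    (hαY : ∀ x, α x (Y x) = 0)
    (hdαY : ∀ x v, extD α x ![Y x, v] = γ x (R x) * α x v - γ x v)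
    (h0 : ∀ x, 0 ≤ γ x (R x)) (x : M) : γ x (R x) = 0 := by
  obtain ⟨ρ, hρ⟩ := SmoothPartitionOfUnity.exists_isSubordinate_chartAt_source (𝓡 d) M
  let s : Finset M := (ρ.locallyFinite.finite_nonempty_of_compact).toFinset
  have hs (i : M) (hi : i ∉ s) (z : M) : ρ i z = 0 := by
    by_contra hz
    exact hi ((Set.Finite.mem_toFinset _).2 ⟨z, hz⟩)
  have hsum (z : M) : ∑ i ∈ s, ρ i z = 1 := by
    rw [← ρ.sum_eq_one (mem_univ z), finsum_eq_sum_of_support_subset]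
    intro i hi
    by_contra his
    exact hi (hs i his z)
  have hρs (i : M) : tsupport (ρ i) ⊆ (extChartAt (𝓡 d) i).source := by
    rw [extChartAt_source]
    exact hρ i
  have hρc (i : M) : Continuous (ρ i) := (ρ i).contMDiff.continuous
  have hf : Continuous fun z ↦ n * γ z (R z) :=
    continuous_const.mul (contMDiff_oneForm_apply γ hR.smooth).continuous
  -- the sum over the charts of the local integrals weighted by the partition of unity
  let J (u : M → ℝ) : ℝ := ∑ j ∈ s, chartIntegral α j fun z ↦ ρ j z * u z
  have hmul (i : M) (u : M → ℝ) :
      tsupport (fun z ↦ ρ i z * u z) ⊆ (extChartAt (𝓡 d) i).source :=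
    (tsupport_mul_subset_left (f := ρ i) (g := u)).trans (hρs i)
  -- on functions supported in one chart domain `J` is the integral in this chart
  have hJ {u : M → ℝ} (hu : Continuous u) {i : M}
      (hi : tsupport u ⊆ (extChartAt (𝓡 d) i).source) : J u = chartIntegral α i u := by
    have h1 : u = fun z ↦ ∑ j ∈ s, ρ j z * u z := by
      ext z
      rw [← Finset.sum_mul, hsum, one_mul]
    conv_rhs => rw [h1]
    rw [chartIntegral_sum hα (u := fun j z ↦ ρ j z * u z) (fun j _ ↦ (hρc j).mul hu)
      fun j _ ↦ (tsupport_mul_subset_right (f := ρ j) (g := u)).trans hi]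
    refine Finset.sum_congr rfl fun j _ ↦ chartIntegral_eq_of_support α (fun z hz ↦ ?_)
      fun z hz ↦ ?_
    · exact hρs j (subset_tsupport _ (left_ne_zero_of_mul hz))
    · exact hi (subset_tsupport _ (right_ne_zero_of_mul hz))
  have hJsum {u : M → M → ℝ} (hu : ∀ i, Continuous (u i)) :
      J (fun z ↦ ∑ i ∈ s, u i z) = ∑ i ∈ s, J (u i) := by
    simp only [J, Finset.mul_sum]
    rw [Finset.sum_comm]
    exact Finset.sum_congr rfl fun j _ ↦ chartIntegral_sum hα (fun i _ ↦ (hρc j).mul (hu i))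
      fun i _ ↦ hmul j (u i)
  -- the divergence of `ρ i • Y`, which is supported in the chart domain at `i`
  let u (i : M) : M → ℝ := fun z ↦ ρ i z * (n * γ z (R z)) + lieDeriv Y (ρ i) z
  have hu (i : M) : Continuous (u i) :=
    ((hρc i).mul hf).add (continuous_lieDeriv (ρ i).contMDiff hY)
  have hui (i : M) : tsupport (u i) ⊆ tsupport (ρ i) := by
    refine closure_minimal (fun z hz ↦ ?_) (isClosed_tsupport _)
    by_contra hzs
    refine hz ?_
    have hev : ρ i =ᶠ[𝓝 z] fun _ ↦ 0 := notMem_tsupport_iff_eventuallyEq.1 hzs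
    have hmf : mfderiv (𝓡 d) 𝓘(ℝ, ℝ) (ρ i) z = 0 := by
      rw [hev.mfderiv_eq]
      exact mfderiv_const
    have hρz : ρ i z = 0 := hev.self_of_nhds
    have hlie : lieDeriv Y (ρ i) z = 0 := by
      rw [lieDeriv, hmf]
      rfl
    simp only [u, hρz, zero_mul, zero_add, hlie]
  have hJu (i : M) : J (u i) = 0 := by
    rw [hJ (hu i) ((hui i).trans (hρs i))]
    exact chartIntegral_divergence hd hα hγ hR hY hαY hdαY (ρ i).contMDiff (hρs i)
  have htotal : J (fun z ↦ n * γ z (R z)) = 0 := by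
    have h1 : (fun z ↦ n * γ z (R z)) = fun z ↦ ∑ i ∈ s, u i z := by
      ext z
      simp only [u, Finset.sum_add_distrib, ← Finset.sum_mul, hsum, one_mul,
        lieDeriv_sum_eq_zero Y (fun i ↦ (ρ i).contMDiff) hsum, add_zero]
    rw [h1, hJsum hu]
    exact Finset.sum_eq_zero fun i _ ↦ hJu i
  have hnn (j z : M) : 0 ≤ ρ j z * (n * γ z (R z)) :=
    mul_nonneg (ρ.nonneg j z) (mul_nonneg n.cast_nonneg (h0 z))
  have hzero := (Finset.sum_eq_zero_iff_of_nonneg fun j _ ↦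
    chartIntegral_nonneg α (c := j) (hnn j)).1 htotal
  obtain ⟨j, hj, hjx⟩ : ∃ j ∈ s, ρ j x ≠ 0 := by
    by_contra! h
    simpa [Finset.sum_eq_zero h] using hsum x
  have hfin := eq_zero_of_chartIntegral_eq_zero hα ((hρc j).mul hf) (hmul j _) (hnn j)
    (hzero j hj) (hρs j (subset_tsupport _ hjx))
  rcases mul_eq_zero.1 ((mul_eq_zero.1 hfin).resolve_left hjx) with h | h
  · exact absurd (Nat.cast_eq_zero.1 h) (by omega)
  · exact h

end Stokes

/-! ### The isotopy -/

section Final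

open Set Topology _root_.Filter

variable {d n : ℕ} {M : Type*} [TopologicalSpace M] [ChartedSpace (EuclideanSpace ℝ (Fin d)) M]
  [IsManifold (𝓡 d) ∞ M]

variable {α α₀ : OneForm d M} {R X Z : (x : M) → TangentSpace (𝓡 d) x} {Φ : ℝ → M → M}

lemma extD_add_smul_of_isClosedForm (hclosed : IsClosedForm ⇑α₀) (t : ℝ) (x : M)
    (v w : TangentSpace (𝓡 d) x) : extD ⇑(α₀ + t • α) x ![v, w] = t * extD α x ![v, w] := by
  rw [extD_add_smul, hclosed x]
  exact zero_add _

/-- If all the forms `α₀ + t α` with `t > 0` have trivial kernel, then `α₀(R) ≥ 0` for the Reeb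
field `R` of `α₀ + α`: otherwise `R` would lie in the kernel of one of these forms. -/
lemma apply_reeb_nonneg (hclosed : IsClosedForm ⇑α₀)
    (hker : ∀ t : ℝ, 0 < t → HasTrivialKernel ⇑(α₀ + t • α))
    (hR : IsReebField ⇑(α₀ + (1 : ℝ) • α) R) (x : M) : 0 ≤ α₀ x (R x) := by
  by_contra! hneg
  have h1 : α₀ x (R x) + 1 * α x (R x) = 1 := hR.apply_eq_one x
  have hpos : 0 < α x (R x) := by linarith
  have hR0 : R x = 0 := by
    refine hker (-α₀ x (R x) / α x (R x)) (div_pos (by linarith) hpos) x (R x) ?_ fun w ↦ ?_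
    · change α₀ x (R x) + -α₀ x (R x) / α x (R x) * α x (R x) = 0
      rw [div_mul_cancel₀ _ hpos.ne', add_neg_cancel]
    · have h2 := hR.extD_eq_zero x w
      rw [extD_add_smul_of_isClosedForm hclosed, one_mul] at h2
      rw [extD_add_smul_of_isClosedForm hclosed, h2, mul_zero]
  rw [hR0, map_zero] at hneg
  exact lt_irrefl _ hneg

lemma exists_smul_sub_oneForm {f : M → ℝ} (hf : ContMDiff (𝓡 d) 𝓘(ℝ, ℝ) ∞ f) (α γ : OneForm d M) :
    ∃ β : OneForm d M, ∀ x v, β x v = f x * α x v - γ x v :=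
  ⟨⟨fun x ↦ f x • α x, hf.smul_section α.contMDiff⟩ - γ, fun _ _ ↦ rfl⟩

/-- The form `α₀` vanishes on the Reeb field `R` of `α₀ + α`. -/
theorem apply_reeb_eq_zero [T2Space M] [CompactSpace M] (hn : 1 ≤ n) (hd : d = 2 * n + 1)
    (hclosed : IsClosedForm ⇑α₀) (hker : ∀ t : ℝ, 0 < t → HasTrivialKernel ⇑(α₀ + t • α))
    (hR : IsReebField ⇑(α₀ + (1 : ℝ) • α) R) (x : M) : α₀ x (R x) = 0 := by
  have h1 := hker 1 one_pos
  obtain ⟨β, hβ⟩ := exists_smul_sub_oneForm (contMDiff_oneForm_apply α₀ hR.smooth)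
    (α₀ + (1 : ℝ) • α) α₀
  obtain ⟨Y, hY, hαY, hdαY⟩ := exists_contraction_eq (β := β) h1 hR fun x ↦ by
    rw [hβ, hR.apply_eq_one, mul_one, sub_self]
  exact apply_reeb_eq_zero_of_nonneg hn hd h1 hclosed hR hY hαY
    (fun x v ↦ (hdαY x v).trans (hβ x v)) (apply_reeb_nonneg hclosed hker hR) x

lemma isReebField_of_apply_eq_zero (hclosed : IsClosedForm ⇑α₀)
    (hR : IsReebField ⇑(α₀ + (1 : ℝ) • α) R) (h0 : ∀ x, α₀ x (R x) = 0) :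
    IsReebField (⇑α) R where
  smooth := hR.smooth
  apply_eq_one x := by
    have h1 : α₀ x (R x) + 1 * α x (R x) = 1 := hR.apply_eq_one x
    rwa [h0, zero_add, one_mul] at h1
  extD_eq_zero x v := by
    have h1 := hR.extD_eq_zero x v
    rwa [extD_add_smul_of_isClosedForm hclosed, one_mul] at h1

/-- The common kernel of `α` and `dα` is trivial, since the kernel of `dα` is spanned by `R` and
`α(R) = 1`. -/
lemma hasTrivialKernel_of_reeb (hclosed : IsClosedForm ⇑α₀)
    (hker : HasTrivialKernel ⇑(α₀ + (1 : ℝ) • α)) (hR : IsReebField (⇑α) R)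
    (h0 : ∀ x, α₀ x (R x) = 0) : HasTrivialKernel ⇑α := by
  intro x v hv hdv
  have happ (u : TangentSpace (𝓡 d) x) : (α₀ + (1 : ℝ) • α) x u = α₀ x u + 1 * α x u := rfl
  have key : v = α₀ x v • R x := eq_of_dual_eq hker fun w ↦ by
    rw [extD_smul_left, extD_add_smul_of_isClosedForm hclosed,
      extD_add_smul_of_isClosedForm hclosed, hdv, hR.extD_eq_zero,
      (((α₀ + (1 : ℝ) • α) x).map_smul (α₀ x v) (R x) :), happ v, happ (R x), hv, h0,
      hR.apply_eq_one, smul_eq_mul]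
    ring
  have h2 : α x v = α₀ x v * α x (R x) := by
    conv_lhs => rw [key]
    rw [map_smul, smul_eq_mul]
  rw [hv, hR.apply_eq_one, mul_one] at h2
  rw [key, ← h2, zero_smul]

lemma IsFlow.mfderiv_zero (hΦ : IsFlow X Φ) (β : OneForm d M) (x : M) (v : TangentSpace (𝓡 d) x) :
    β (Φ 0 x) (mfderiv (𝓡 d) (𝓡 d) (Φ 0) x v) = β x v := by
  have h : Φ 0 = id := funext hΦ.zero
  rw [h, mfderiv_id]
  rfl

/-- The flow of a field `X` with `α₀(X) = 0` preserves the closed form `α₀`. -/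
lemma IsFlow.pullback_closed (hΦ : IsFlow X Φ) (hclosed : IsClosedForm ⇑α₀)
    (hX : ∀ x, α₀ x (X x) = 0) (s : ℝ) (x : M) (v : TangentSpace (𝓡 d) x) :
    α₀ (Φ s x) (mfderiv (𝓡 d) (𝓡 d) (Φ s) x v) = α₀ x v := by
  have h (r : ℝ) := hΦ.hasDerivAt_pullback α₀ hX x v r
  have h' (r : ℝ) : HasDerivAt (fun s ↦ α₀ (Φ s x) (mfderiv (𝓡 d) (𝓡 d) (Φ s) x v)) 0 r :=
    (h r).congr_deriv (by rw [hclosed]; rfl)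
  rw [← hΦ.mfderiv_zero α₀ x v]
  exact is_const_of_deriv_eq_zero (fun r ↦ (h' r).differentiableAt) (fun r ↦ (h' r).deriv) s 0

/-- If `X` is in the kernel of `α` and `dα(X, ·) = α₀` is closed, the flow of `X` pulls `α` back to
`α + s α₀` at time `s`. -/
lemma IsFlow.pullback_eq_add_smul (hΦ : IsFlow X Φ) (hclosed : IsClosedForm ⇑α₀)
    (hX₀ : ∀ x, α₀ x (X x) = 0) (hX : ∀ x, α x (X x) = 0)
    (hdX : ∀ x v, extD α x ![X x, v] = α₀ x v) (s : ℝ) (x : M) (v : TangentSpace (𝓡 d) x) :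
    α (Φ s x) (mfderiv (𝓡 d) (𝓡 d) (Φ s) x v) = α x v + s * α₀ x v := by
  have h (r : ℝ) : HasDerivAt
      (fun s ↦ α (Φ s x) (mfderiv (𝓡 d) (𝓡 d) (Φ s) x v) - s * α₀ x v) 0 r :=
    ((hΦ.hasDerivAt_pullback α hX x v r).sub ((hasDerivAt_id r).mul_const (α₀ x v))).congr_deriv
      (by rw [hdX, hΦ.pullback_closed hclosed hX₀, one_mul, sub_self])
  have key := is_const_of_deriv_eq_zero (fun r ↦ (h r).differentiableAt)
    (fun r ↦ (h r).deriv) s 0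
  simp only [zero_mul, sub_zero] at key
  rw [hΦ.mfderiv_zero] at key
  linarith

omit [IsManifold (𝓡 d) ∞ M] in
/-- The flow map at time `s`, as a diffeomorphism. -/
def IsFlow.toDiffeomorph (hΦ : IsFlow X Φ) (s : ℝ) : M ≃ₘ⟮𝓡 d, 𝓡 d⟯ M where
  toFun := Φ s
  invFun := Φ (-s)
  left_inv x := by rw [← hΦ.add, neg_add_cancel, hΦ.zero]
  right_inv x := by rw [← hΦ.add, add_neg_cancel, hΦ.zero]
  contMDiff_toFun := hΦ.contMDiff_apply s
  contMDiff_invFun := hΦ.contMDiff_apply (-s)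

omit [IsManifold (𝓡 d) ∞ M] in
lemma IsFlow.mfderiv_surjective (hΦ : IsFlow X Φ) (s : ℝ) (x : M) :
    Function.Surjective (mfderiv (𝓡 d) (𝓡 d) (Φ s) x) :=
  ((hΦ.toDiffeomorph s).mfderivToContinuousLinearEquiv (by simp) x).surjective

/-- The flow of the field dual to `α₀` preserves the Reeb field `Z` of `α`, as `Z` is also the Reeb
field of each form `α + s α₀`. -/
lemma IsFlow.mfderiv_reeb (hΦ : IsFlow X Φ) (hclosed : IsClosedForm ⇑α₀)
    (hker : HasTrivialKernel ⇑α) (hZ : IsReebField (⇑α) Z) (hZ₀ : ∀ x, α₀ x (Z x) = 0)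
    (hX₀ : ∀ x, α₀ x (X x) = 0) (hX : ∀ x, α x (X x) = 0)
    (hdX : ∀ x v, extD α x ![X x, v] = α₀ x v) (s : ℝ) (x : M) :
    mfderiv (𝓡 d) (𝓡 d) (Φ s) x (Z x) = Z (Φ s x) := by
  have hpull : IsPullback (Φ s) ⇑α ⇑(α + s • α₀) := fun x ↦ by
    ext v
    exact (hΦ.pullback_eq_add_smul hclosed hX₀ hX hdX s x v).symm
  refine eq_of_dual_eq hker fun w ↦ ?_
  obtain ⟨w, rfl⟩ := hΦ.mfderiv_surjective s x w
  rw [← extD_pullback (hΦ.contMDiff_apply s) hpull, extD_add_smul, hclosed, hZ.extD_eq_zero,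
    hZ.extD_eq_zero, hZ.apply_eq_one, hΦ.pullback_eq_add_smul hclosed hX₀ hX hdX, hZ.apply_eq_one,
    hZ₀]
  simp

omit [IsManifold (𝓡 d) ∞ M] in
lemma IsFlow.preservesOrbits (hΦ : IsFlow X Φ)
    (h : ∀ s x, mfderiv (𝓡 d) (𝓡 d) (Φ s) x (Z x) = Z (Φ s x)) (s : ℝ) :
    PreservesOrbits Z (Φ s) := by
  have hsub (s : ℝ) (x : M) : Φ s '' orbit Z x ⊆ orbit Z (Φ s x) := by
    rintro _ ⟨_, ⟨γ, hγ, h0, r, rfl⟩, rfl⟩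
    refine ⟨fun t ↦ Φ s (γ t), fun t ↦ ?_, congrArg (Φ s) h0, r, rfl⟩
    have h1 := (hΦ.mdifferentiableAt s (γ t)).hasMFDerivAt.comp t (hγ t)
    refine h1.congr_mfderiv (ContinuousLinearMap.ext_ring ?_)
    change mfderiv (𝓡 d) (𝓡 d) (Φ s) (γ t) ((1 : ℝ) • Z (γ t)) = (1 : ℝ) • Z (Φ s (γ t))
    rw [one_smul, one_smul, h]
  refine fun x ↦ (hsub s x).antisymm fun y hy ↦ ?_
  have h1 := hsub (-s) _ ⟨y, hy, rfl⟩
  rw [← hΦ.add, neg_add_cancel, hΦ.zero] at h1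
  exact ⟨_, h1, by rw [← hΦ.add, add_neg_cancel, hΦ.zero]⟩

/-- The isotopy is the flow of the field `X` with `α(X) = 0` and `dα(X, ·) = α₀`, with time rescaled by
`1 / t`. -/
theorem isotopicThrough_preservesOrbits [T2Space M] [CompactSpace M]
    (hclosed : IsClosedForm ⇑α₀) (hker : HasTrivialKernel ⇑α) (hZ : IsReebField (⇑α) Z)
    (hZ₀ : ∀ x, α₀ x (Z x) = 0) {t : ℝ} (ht : 0 < t) :
    IsotopicThrough (PreservesOrbits Z) ⇑(t • α) ⇑(α₀ + t • α) := by
  obtain ⟨X, hXs, hX, hdX⟩ := exists_contraction_eq hker hZ hZ₀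
  have hX₀ (x : M) : α₀ x (X x) = 0 := by
    have h := extD_swap α x (X x) (X x)
    rw [hdX] at h
    linarith
  obtain ⟨Φ, hΦ⟩ := exists_isFlow hXs
  refine ⟨fun s ↦ hΦ.toDiffeomorph (s / t), ⟨?_, fun x ↦ ?_⟩, fun x ↦ ?_, fun s _ ↦ ?_⟩
  · refine ContMDiff.contMDiffOn (hΦ.contMDiff.comp (g := fun p : ℝ × M ↦ Φ p.1 p.2)
      (f := fun p : ℝ × M ↦ (p.1 / t, p.2)) (ContMDiff.prodMk ?_ contMDiff_snd))
    exact (contDiff_id.div_const t).contMDiff.comp contMDiff_fst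
  · rw [zero_div]
    exact hΦ.zero x
  · ext v
    have h := hΦ.pullback_eq_add_smul hclosed hX₀ hX hdX (1 / t) x v
    change α₀ x v + t * α x v = t * α (Φ (1 / t) x) (mfderiv (𝓡 d) (𝓡 d) (Φ (1 / t)) x v)
    rw [h]
    field_simp
    ring
  · exact hΦ.preservesOrbits (hΦ.mfderiv_reeb hclosed hker hZ hZ₀ hX₀ hX hdX) _

end Final

/-! ### The contact condition for the second form -/

section ContactForm

variable {n : ℕ} {M : Type*} [TopologicalSpace M]
  [ChartedSpace (EuclideanSpace ℝ (Fin (2 * n + 1))) M] [IsManifold (𝓡 (2 * n + 1)) ∞ M]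

/-- If `α₀ + α` is a contact form while `α₀` and `dα` have a common kernel at each point, then
`α₀ ∧ (dα)ⁿ = 0` and hence `α` is a contact form. -/
lemma isContactForm_of_add {α α₀ : OneForm (2 * n + 1) M}
    {R : (x : M) → TangentSpace (𝓡 (2 * n + 1)) x} (hclosed : IsClosedForm ⇑α₀)
    (h1 : IsContactForm ⇑(α₀ + (1 : ℝ) • α)) (hR : IsReebField (⇑α) R)
    (h0 : ∀ x, α₀ x (R x) = 0) : IsContactForm ⇑α := by
  intro x hx
  refine h1 x ?_
  have hη : extD ⇑(α₀ + (1 : ℝ) • α) x = extD α x := by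
    ext v
    have hv : v = ![v 0, v 1] := List.ofFn_inj.mp rfl
    rw [hv, extD_add_smul_of_isClosedForm hclosed, one_mul]
  have ha : toForm ((α₀ + (1 : ℝ) • α) x).toLinearMap =
      toForm (α₀ x).toLinearMap + toForm (α x).toLinearMap := by
    ext v
    change α₀ x (v 0) + 1 * α x (v 0) = α₀ x (v 0) + α x (v 0)
    rw [one_mul]
  rw [hη, ha, wedge_add_left, hx, add_zero]
  by_contra hne
  have hR0 : R x = 0 := eq_zero_of_wedge_ne_zero
    ((finrank_euclideanSpace_fin : Module.finrank ℝ (EuclideanSpace ℝ (Fin (2 * n + 1))) = _))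
    hne (h0 x) (hR.extD_eq_zero x)
  have := hR.apply_eq_one x
  rw [hR0, map_zero] at this
  exact zero_ne_one this

end ContactForm

end ContactIsotopy

end

theorem proposition3p2 (n : ℕ) (hn : 1 ≤ n)
    {M : Type*} [TopologicalSpace M] [T2Space M] [CompactSpace M]
    [ChartedSpace (EuclideanSpace ℝ (Fin (2 * n + 1))) M] [IsManifold (𝓡 (2 * n + 1)) ∞ M]
    (α₀ α : ContactIsotopy.OneForm (2 * n + 1) M)
    (hclosed : ContactIsotopy.IsClosedForm α₀) (hns : ContactIsotopy.IsNonsingular α₀)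
    (hcontact : ∀ t : ℝ, 0 < t → ContactIsotopy.IsContactForm ⇑(α₀ + t • α)) :
    ContactIsotopy.IsContactForm α ∧
      ∃ Z : (x : M) → TangentSpace (𝓡 (2 * n + 1)) x, ContactIsotopy.IsReebField α Z ∧
        ∀ t : ℝ, 0 < t →
          ContactIsotopy.IsotopicThrough (ContactIsotopy.PreservesOrbits Z)
            ⇑(t • α) ⇑(α₀ + t • α) := by
  have hker (t : ℝ) (ht : 0 < t) := (hcontact t ht).hasTrivialKernel
  obtain ⟨R, hR⟩ := ContactIsotopy.exists_isReebField (odd_two_mul_add_one n) (hker 1 one_pos)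
  have h0 := ContactIsotopy.apply_reeb_eq_zero hn rfl hclosed hker hR
  have hRα := ContactIsotopy.isReebField_of_apply_eq_zero hclosed hR h0
  have hkerα := ContactIsotopy.hasTrivialKernel_of_reeb hclosed (hker 1 one_pos) hRα h0
  exact ⟨ContactIsotopy.isContactForm_of_add hclosed (hcontact 1 one_pos) hRα h0, R, hRα,
    fun t ht ↦ ContactIsotopy.isotopicThrough_preservesOrbits hclosed hkerα hRα h0 ht⟩
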